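/- For $v>0$ and an integer $d\ge 0$, let $SLC_1(v,d)$ be the class of probability density functions $p$ on $\mathbb{R}^d$ (with respect to Lebesgue measure) of the form $p(x)=g(x)\,\phi_{vI}(x)$, where $\phi_{vI}(x)=(2\pi v)^{-d/2}e^{-|x|^2/(2v)}$ is the $N_d(0,vI)$ density and $g$ is log-concave, i.e. $g=e^{-\varphi}$ with $\varphi:\mathbb{R}^d\to(-\infty,\infty]$ convex. Let $\sigma,\tau>0$ and let $X,Y$ be independent random vectors in $\mathbb{R}^d$ with densities $p\in SLC_1(\sigma^2,d)$ and $q\in SLC_1(\tau^2,d)$. Then $p\star q(z)=\int p(x)q(z-x)\,dx$ exists for every $z$, the random vector $Z=X+Y$ has density $p_Z=p\star q$, and $p\star q\in SLC_1(\sigma^2+\tau^2,d)$. Suppose moreover that $p$ and $q$ are everywhere positive, that $\varphi_p=-\log p$ and $\varphi_q=-\log q$ are $C^2$, and that $p$ and $q$ have finite Fisher information, $\int|\nabla\varphi_p|^2p<\infty$ and $\int|\nabla\varphi_q|^2q<\infty$. Then $p_Z>0$ everywhere, $-\log p_Z$ is $C^2$, and for every $z\in\mathbb{R}^d$, in the positive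 semidefinite order, $$\nabla^2(-\log p_Z)(z)\ \ge\ E\Big\{\big[(\nabla^2\varphi_p(X))^{-1}+(\nabla^2\varphi_q(Y))^{-1}\big]^{-1}\,\Big|\,X+Y=z\Big\}.$$ Here, for $M(x,y)=[(\nabla^2\varphi_p(x))^{-1}+(\nabla^2\varphi_q(y))^{-1}]^{-1}$, the right side is the entrywise convergent integral $\frac1{p_Z(z)}\int M(x,z-x)\,p(x)\,q(z-x)\,dx$; the entries of $M(X,Y)$ are integrable, and this function of $z$, evaluated at $z=Z$, is a version of the conditional expectation $E[M(X,Y)\mid Z]$. -/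

import Mathlib

open MeasureTheory ProbabilityTheory

/-- A function `g : ℝᵈ → ℝ` is log-concave if `g = e^{-φ}` for a convex function
`φ : ℝᵈ → (-∞, ∞]`, with `e^{-∞} = 0`. -/
def IsLogConcave {d : ℕ} (g : EuclideanSpace ℝ (Fin d) → ℝ) : Prop :=
  ∃ φ : EuclideanSpace ℝ (Fin d) → EReal,
    (∀ x, φ x ≠ ⊥) ∧
    (∀ x y : EuclideanSpace ℝ (Fin d), ∀ θ : ℝ, 0 < θ → θ < 1 →
      φ (θ • x + (1 - θ) • y) ≤ (θ : EReal) * φ x + ((1 - θ : ℝ) : EReal) * φ y) ∧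
    ∀ x, g x = (EReal.exp (-φ x)).toReal

/-- A (Borel) probability density function with respect to Lebesgue measure on `ℝᵈ`. -/
structure IsDensity {d : ℕ} (p : EuclideanSpace ℝ (Fin d) → ℝ) : Prop where
  measurable : Measurable p
  nonneg : ∀ x, 0 ≤ p x
  integrable : Integrable p volume
  integral_eq_one : ∫ x, p x = 1

/-- The density of the centred Gaussian law `N_d(0, v I)`. -/
noncomputable def gaussianDensity (d : ℕ) (v : ℝ) (x : EuclideanSpace ℝ (Fin d)) : ℝ :=
  (2 * Real.pi * v) ^ (-(d : ℝ) / 2) * Real.exp (-‖x‖ ^ 2 / (2 * v))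

/-- `SLC₁(v, d)`: the probability densities on `ℝᵈ` of the form `p = g ϕ_{vI}` with `g`
log-concave. The parameter `v > 0` is the variance parameter. -/
def SLC1 (v : ℝ) (d : ℕ) : Set (EuclideanSpace ℝ (Fin d) → ℝ) :=
  {p | IsDensity p ∧ ∃ g : EuclideanSpace ℝ (Fin d) → ℝ,
    IsLogConcave g ∧ ∀ x, p x = g x * gaussianDensity d v x}

/-- The random vector `X` has density `p` with respect to Lebesgue measure. -/
def HasDensity {d : ℕ} {Ω : Type*} [MeasurableSpace Ω] (P : Measure Ω)
    (X : Ω → EuclideanSpace ℝ (Fin d)) (p : EuclideanSpace ℝ (Fin d) → ℝ) : Prop :=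
  P.map X = volume.withDensity fun x => ENNReal.ofReal (p x)

/-- The convolution `(p ⋆ q)(z) = ∫ p(x) q(z - x) dx`. -/
noncomputable def conv {d : ℕ} (p q : EuclideanSpace ℝ (Fin d) → ℝ) :
    EuclideanSpace ℝ (Fin d) → ℝ :=
  convolution p q (ContinuousLinearMap.mul ℝ ℝ) volume

/-- The potential `φ_p = -log p`. -/
noncomputable def potential {d : ℕ} (p : EuclideanSpace ℝ (Fin d) → ℝ) :
    EuclideanSpace ℝ (Fin d) → ℝ :=
  fun x => -Real.log (p x)

/-- The Hessian matrix `∇² f (x)`. -/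
noncomputable def hessian {d : ℕ} (f : EuclideanSpace ℝ (Fin d) → ℝ)
    (x : EuclideanSpace ℝ (Fin d)) : Matrix (Fin d) (Fin d) ℝ :=
  Matrix.of fun i j =>
    iteratedFDeriv ℝ 2 f x ![EuclideanSpace.single i 1, EuclideanSpace.single j 1]

/-- A positive density with a `C²` potential and finite Fisher information
`∫ |∇φ_p|² p < ∞`. -/
structure IsRegularDensity {d : ℕ} (p : EuclideanSpace ℝ (Fin d) → ℝ) : Prop where
  pos : ∀ x, 0 < p x
  contDiff : ContDiff ℝ 2 (potential p)
  fisher : Integrable (fun x => ‖gradient (potential p) x‖ ^ 2 * p x) volume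

/-- The matrix `((∇²φ_p(x))⁻¹ + (∇²φ_q(y))⁻¹)⁻¹`. -/
noncomputable def parallelHessian {d : ℕ} (p q : EuclideanSpace ℝ (Fin d) → ℝ)
    (x y : EuclideanSpace ℝ (Fin d)) : Matrix (Fin d) (Fin d) ℝ :=
  ((hessian (potential p) x)⁻¹ + (hessian (potential q) y)⁻¹)⁻¹

/-- The entrywise conditional expectation `E[M(X, Y) | X + Y = z]` for independent `X`, `Y` with
densities `p`, `q`, computed with the conditional density `x ↦ p(x) q(z - x) / (p ⋆ q)(z)` of `X`
given `X + Y = z`. -/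
noncomputable def condMeanGivenSum {d : ℕ} (p q : EuclideanSpace ℝ (Fin d) → ℝ)
    (M : EuclideanSpace ℝ (Fin d) → EuclideanSpace ℝ (Fin d) → Matrix (Fin d) (Fin d) ℝ)
    (z : EuclideanSpace ℝ (Fin d)) : Matrix (Fin d) (Fin d) ℝ :=
  Matrix.of fun i j => (∫ x, M x (z - x) i j * (p x * q (z - x))) / conv p q z

/-! Everything rests on the Prékopa–Leindler inequality: integrating a jointly log-concave function
over some of its variables leaves a log-concave function.

Strong log-concavity of `p ⋆ q`: divide the integrand `p(x) q(z - x)` by the Gaussian density of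
variance `v + w` at `z`. Completing the square shows that the quotient is a constant times `f(x) g(z
- x)` times a Gaussian in `x - v/(v+w) z`, hence jointly log-concave in `(x, z)`, and
Prékopa–Leindler applies (`conv_mem_SLC1`).

Hessian bound: fix `z` and a direction `a`, and write `φ`, `ψ` for the potentials of `p`, `q`.
Minimising the quadratic form of `φ(x) + ψ(z + t a - x)` over the `x`-direction leaves a Schur
complement in `t`, the parallel sum `m(x) = a · M(x, z - x) a` (`Matrix.PosDef.parallelSum_le`). So
if `η` is smooth, compactly supported and strictly below `m`, then `φ(x) + ψ(z + t a - x) - η(x)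
t²/2` is still convex in `(x, t)` for small `t` (`exists_perturbedForm_nonneg`). The midpoint
Prékopa–Leindler inequality at `t = ±h`, with Jensen's inequality for the factors `exp(η h²/2)`,
bounds the symmetric second difference of `-log (p ⋆ q)` below by conditional means of `η`. Letting
`h → 0` gives the bound with `η` in place of `m` (`integral_div_conv_le_second_deriv`), and `η → m`
with Fatou's lemma gives it for `m`. No derivative of `φ` or `ψ` beyond the second is needed, and
the integrability of `m` comes out as a conclusion.

Regularity: log-concave densities are bounded, so finite Fisher information puts `∇p` and `∇q` in
`L²`. One derivative on each factor then makes `p ⋆ q` twice continuously differentiable.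

Conditional expectation: the Hessian of `-log (p ⋆ q)`, weighted by `p ⋆ q`, is at most a sum of
convolutions of integrable functions (`conv_mul_second_deriv_potential_le`). With the lower bound
this makes `M(X, Y)` integrable, and Fubini in the coordinates `(x + y, x)` identifies the
conditional expectation. -/

/-! ### Brunn–Minkowski and Prékopa–Leindler inequalities. -/

/-- One-dimensional Brunn–Minkowski inequality for compact sets. -/
theorem volume_add_le_of_isCompact {A B C : Set ℝ} (hA : IsCompact A) (hB : IsCompact B)
    (hA0 : A.Nonempty) (hB0 : B.Nonempty) (h : ∀ a ∈ A, ∀ b ∈ B, a + b ∈ C) :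
    volume A + volume B ≤ volume C := by
  -- With `k = max A` and `l = min B`, the translates `A + l` and `k + B` both lie in `C` and meet
  -- only at `k + l`.
  obtain ⟨k, hkA, hk⟩ := hA.exists_isGreatest hA0
  obtain ⟨l, hlB, hl⟩ := hB.exists_isLeast hB0
  have h1 : volume ((fun x => x + l) '' A) = volume A := by
    simp
  have h2 : volume ((fun x => k + x) '' B) = volume B := by
    simp
  have hm : MeasurableSet ((fun x => k + x) '' B) :=
    (hB.image (by fun_prop)).measurableSet
  have h3 : volume ((fun x => x + l) '' A ∩ (fun x => k + x) '' B) = 0 := by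
    refine measure_mono_null (t := {k + l}) ?_ (by simp)
    rintro _ ⟨⟨a, ha, rfl⟩, ⟨b, hb, hab⟩⟩
    have := hk ha
    have := hl hb
    simp only at hab
    simp only [Set.mem_singleton_iff]
    linarith
  rw [← h1, ← h2, ← measure_union_add_inter _ hm, h3, add_zero]
  apply measure_mono
  rintro _ (⟨a, ha, rfl⟩ | ⟨b, hb, rfl⟩)
  · exact h a ha l hlB
  · exact h k hkA b hb

open Pointwise in
/-- One-dimensional Brunn–Minkowski inequality for measurable sets. -/
theorem volume_smul_add_smul_le {A B C : Set ℝ} (hA : MeasurableSet A) (hB : MeasurableSet B)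
    (hA0 : A.Nonempty) (hB0 : B.Nonempty) {θ : ℝ} (hθ : 0 < θ) (hθ1 : θ < 1)
    (h : ∀ a ∈ A, ∀ b ∈ B, θ * a + (1 - θ) * b ∈ C) :
    ENNReal.ofReal θ * volume A + ENNReal.ofReal (1 - θ) * volume B ≤ volume C := by
  -- Inserting a point of `A` in `K` and of `B` in `L` keeps the compact sets nonempty, so that `∅`
  -- is allowed for `K` and `L`.
  have key : ∀ K ⊆ A, IsCompact K → ∀ L ⊆ B, IsCompact L →
      ENNReal.ofReal θ * volume K + ENNReal.ofReal (1 - θ) * volume L ≤ volume C := by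
    obtain ⟨a, ha⟩ := hA0
    obtain ⟨b, hb⟩ := hB0
    intro K hK hKc L hL hLc
    have e1 : volume (θ • insert a K) = ENNReal.ofReal θ * volume (insert a K) := by
      rw [Measure.addHaar_smul]; simp [abs_of_pos hθ]
    have e2 : volume ((1 - θ) • insert b L) = ENNReal.ofReal (1 - θ) * volume (insert b L) := by
      rw [Measure.addHaar_smul]; simp [abs_of_pos (sub_pos.2 hθ1)]
    calc _ ≤ ENNReal.ofReal θ * volume (insert a K)
          + ENNReal.ofReal (1 - θ) * volume (insert b L) := by
          gcongr <;> exact Set.subset_insert _ _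
      _ = volume (θ • insert a K) + volume ((1 - θ) • insert b L) := by rw [e1, e2]
      _ ≤ _ := by
        refine volume_add_le_of_isCompact ((hKc.insert a).smul θ) ((hLc.insert b).smul _)
          (Set.insert_nonempty _ _).smul_set (Set.insert_nonempty _ _).smul_set ?_
        rintro _ ⟨x, hx, rfl⟩ _ ⟨y, hy, rfl⟩
        exact h x (Set.insert_subset ha hK hx) y (Set.insert_subset hb hL hy)
  rw [hA.measure_eq_iSup_isCompact, hB.measure_eq_iSup_isCompact]
  simp only [ENNReal.mul_iSup]
  refine ENNReal.biSup_add_biSup_le' (p := fun K => K ⊆ A) (q := fun L => L ⊆ B)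
    ⟨∅, Set.empty_subset _⟩ ⟨∅, Set.empty_subset _⟩ ?_
  intro K hK L hL
  -- A non-compact set contributes an empty supremum, which is `0`; `∅` in its place gives the same
  -- value.
  by_cases hKc : IsCompact K <;> by_cases hLc : IsCompact L
  · simpa [hKc, hLc] using key K hK hKc L hL hLc
  · simpa [hKc, hLc] using key K hK hKc ∅ (by simp) isCompact_empty
  · simpa [hKc, hLc] using key ∅ (by simp) isCompact_empty L hL hLc
  · simp [hKc, hLc]

theorem ENNReal.rpow_mul_rpow_le_add (a b : ENNReal) {θ : ℝ} (hθ : 0 < θ) (hθ1 : θ < 1) :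
    a ^ θ * b ^ (1 - θ) ≤ ENNReal.ofReal θ * a + ENNReal.ofReal (1 - θ) * b := by
  have h1 : 0 < 1 - θ := sub_pos.2 hθ1
  rcases eq_or_ne a ⊤ with rfl | ha
  · simp [ENNReal.mul_top, hθ]
  rcases eq_or_ne b ⊤ with rfl | hb
  · rw [ENNReal.mul_top (by simpa using h1)]; simp
  lift a to NNReal using ha
  lift b to NNReal using hb
  rw [← ENNReal.coe_rpow_of_nonneg _ hθ.le, ← ENNReal.coe_rpow_of_nonneg _ h1.le]
  have := NNReal.geom_mean_le_arith_mean2_weighted θ.toNNReal (1 - θ).toNNReal a b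
    (by rw [← Real.toNNReal_add hθ.le h1.le]; simp)
  rw [Real.coe_toNNReal _ hθ.le, Real.coe_toNNReal _ h1.le] at this
  simp only [ENNReal.ofReal]
  exact_mod_cast this

/-- Layer cake plus Brunn–Minkowski on superlevel sets. Brunn–Minkowski needs both sets nonempty;
normalising both suprema to `1` makes them nonempty for every `t < 1` and empty from `1` on, at the
same levels for `F` and `G`. -/
theorem prekopaLeindler_real_normalized {F G H : ℝ → ℝ} (hF : Measurable F) (hG : Measurable G)
    (hH : Measurable H) (hF0 : ∀ x, 0 ≤ F x) (hG0 : ∀ x, 0 ≤ G x) (hH0 : ∀ x, 0 ≤ H x)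
    (hF1 : ∀ x, F x ≤ 1) (hG1 : ∀ x, G x ≤ 1) (hFs : ∀ t < 1, ∃ x, t < F x)
    (hGs : ∀ t < 1, ∃ x, t < G x) {θ : ℝ} (hθ : 0 < θ) (hθ1 : θ < 1)
    (h : ∀ t, 0 < t → t < 1 → ∀ x y, t < F x → t < G y → t < H (θ * x + (1 - θ) * y)) :
    ENNReal.ofReal θ * (∫⁻ x, ENNReal.ofReal (F x))
      + ENNReal.ofReal (1 - θ) * (∫⁻ x, ENNReal.ofReal (G x)) ≤ ∫⁻ x, ENNReal.ofReal (H x) := by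
  rw [lintegral_eq_lintegral_meas_lt _ (.of_forall hF0) hF.aemeasurable,
    lintegral_eq_lintegral_meas_lt _ (.of_forall hG0) hG.aemeasurable,
    lintegral_eq_lintegral_meas_lt _ (.of_forall hH0) hH.aemeasurable,
    ← lintegral_const_mul' _ _ (by simp), ← lintegral_const_mul' _ _ (by simp)]
  refine (le_lintegral_add _ _).trans ?_
  refine setLIntegral_mono' measurableSet_Ioi ?_
  intro t ht
  by_cases ht1 : t < 1
  · refine volume_smul_add_smul_le (measurableSet_lt measurable_const hF)
      (measurableSet_lt measurable_const hG) (hFs t ht1) (hGs t ht1) hθ hθ1 ?_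
    intro a ha b hb
    exact h t ht ht1 a b ha hb
  · have e1 : {x | t < F x} = ∅ := by
      ext x; simpa using (hF1 x).trans (not_lt.1 ht1)
    have e2 : {x | t < G x} = ∅ := by
      ext x; simpa using (hG1 x).trans (not_lt.1 ht1)
    simp [e1, e2]

theorem prekopaLeindler_real_bounded {f g h : ℝ → ENNReal} (hf : Measurable f) (hg : Measurable g)
    (hh : Measurable h) {θ : ℝ} (hθ : 0 < θ) (hθ1 : θ < 1)
    (hfb : ⨆ x, f x ≠ ⊤) (hgb : ⨆ x, g x ≠ ⊤)
    (hfgh : ∀ x y, f x ^ θ * g y ^ (1 - θ) ≤ h (θ * x + (1 - θ) * y)) :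
    (∫⁻ x, f x) ^ θ * (∫⁻ x, g x) ^ (1 - θ) ≤ ∫⁻ x, h x := by
  have h1 : 0 < 1 - θ := sub_pos.2 hθ1
  set S := ⨆ x, f x with hS
  set T := ⨆ x, g x with hT
  have hfS : ∀ x, f x ≤ S := le_iSup f
  have hgT : ∀ x, g x ≤ T := le_iSup g
  rcases eq_or_ne S 0 with hS0 | hS0
  · have : ∀ x, f x = 0 := fun x => le_antisymm (hS0 ▸ hfS x) bot_le
    simp [this, hθ]
  rcases eq_or_ne T 0 with hT0 | hT0
  · have : ∀ x, g x = 0 := fun x => le_antisymm (hT0 ▸ hgT x) bot_le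
    simp [this, h1]
  -- Dividing `f`, `g`, `h` by `S`, `T`, `c` preserves the hypothesis and normalises the suprema.
  -- Capping `h / c` at `1` only makes it finite, as just the levels `t < 1` matter. Weighted AM–GM
  -- then returns from the arithmetic to the geometric mean.
  set c := S ^ θ * T ^ (1 - θ) with hc
  have hc0 : c ≠ 0 := mul_ne_zero (by simp [ENNReal.rpow_eq_zero_iff, hS0, hfb])
    (by simp [ENNReal.rpow_eq_zero_iff, hT0, hgb])
  have hct : c ≠ ⊤ := ENNReal.mul_ne_top (ENNReal.rpow_ne_top_of_nonneg hθ.le hfb)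
    (ENNReal.rpow_ne_top_of_nonneg h1.le hgb)
  have hF1 : ∀ x, f x / S ≤ 1 := fun x => ENNReal.div_le_of_le_mul (by simpa using hfS x)
  have hG1 : ∀ x, g x / T ≤ 1 := fun x => ENNReal.div_le_of_le_mul (by simpa using hgT x)
  have hFt : ∀ x, f x / S ≠ ⊤ := fun x => ne_top_of_le_ne_top ENNReal.one_ne_top (hF1 x)
  have hGt : ∀ x, g x / T ≠ ⊤ := fun x => ne_top_of_le_ne_top ENNReal.one_ne_top (hG1 x)
  have hHt : ∀ x, min (h x / c) 1 ≠ ⊤ := fun x =>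
    ne_top_of_le_ne_top ENNReal.one_ne_top (min_le_right _ _)
  have lt_iff : ∀ {a : ENNReal} (_ : a ≠ ⊤) {t : ℝ} (_ : 0 ≤ t),
      t < a.toReal ↔ ENNReal.ofReal t < a := fun ha t ht =>
    (ENNReal.ofReal_lt_iff_lt_toReal ht ha).symm
  have key := prekopaLeindler_real_normalized (F := fun x => (f x / S).toReal)
    (G := fun x => (g x / T).toReal) (H := fun x => (min (h x / c) 1).toReal)
    (hf.div_const S).ennreal_toReal (hg.div_const T).ennreal_toReal
    ((hh.div_const c).min measurable_const).ennreal_toReal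
    (fun _ => ENNReal.toReal_nonneg) (fun _ => ENNReal.toReal_nonneg)
    (fun _ => ENNReal.toReal_nonneg)
    (fun x => ENNReal.toReal_le_of_le_ofReal zero_le_one (by simpa using hF1 x))
    (fun x => ENNReal.toReal_le_of_le_ofReal zero_le_one (by simpa using hG1 x))
    ?_ ?_ hθ hθ1 ?_
  · simp only [ENNReal.ofReal_toReal (hFt _), ENNReal.ofReal_toReal (hGt _),
      ENNReal.ofReal_toReal (hHt _)] at key
    have hle : ∫⁻ x, min (h x / c) 1 ≤ (∫⁻ x, h x) / c := by
      simp only [div_eq_mul_inv]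
      rw [← lintegral_mul_const _ hh]
      exact lintegral_mono fun x => min_le_left _ _
    have := (ENNReal.rpow_mul_rpow_le_add _ _ hθ hθ1).trans (key.trans hle)
    have ef : ∫⁻ x, f x / S = (∫⁻ x, f x) / S := by
      simp only [div_eq_mul_inv]; rw [lintegral_mul_const _ hf]
    have eg : ∫⁻ x, g x / T = (∫⁻ x, g x) / T := by
      simp only [div_eq_mul_inv]; rw [lintegral_mul_const _ hg]
    rw [ef, eg, ENNReal.div_rpow_of_nonneg _ _ hθ.le, ENNReal.div_rpow_of_nonneg _ _ h1.le,
      ENNReal.le_div_iff_mul_le (.inl hc0) (.inl hct), hc] at this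
    convert this using 1
    have a1 : S ^ θ ≠ 0 := by simp [ENNReal.rpow_eq_zero_iff, hS0, hfb]
    have a2 : T ^ (1 - θ) ≠ 0 := by simp [ENNReal.rpow_eq_zero_iff, hT0, hgb]
    have a3 : S ^ θ ≠ ⊤ := ENNReal.rpow_ne_top_of_nonneg hθ.le hfb
    have a4 : T ^ (1 - θ) ≠ ⊤ := ENNReal.rpow_ne_top_of_nonneg h1.le hgb
    rw [mul_mul_mul_comm, ENNReal.div_mul_cancel a1 a3, ENNReal.div_mul_cancel a2 a4]
  · intro t ht
    rcases lt_or_ge t 0 with h0 | h0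
    · exact ⟨0, h0.trans_le ENNReal.toReal_nonneg⟩
    have : ENNReal.ofReal t * S < ⨆ x, f x := by
      rw [← hS]
      calc ENNReal.ofReal t * S < 1 * S := by
            rw [ENNReal.mul_lt_mul_iff_left hS0 hfb]; simpa using ht
        _ = S := one_mul _
    obtain ⟨x, hx⟩ := lt_iSup_iff.1 this
    refine ⟨x, (lt_iff (hFt x) h0).2 ?_⟩
    rwa [ENNReal.lt_div_iff_mul_lt (.inl hS0) (.inl hfb)]
  · intro t ht
    rcases lt_or_ge t 0 with h0 | h0
    · exact ⟨0, h0.trans_le ENNReal.toReal_nonneg⟩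
    have : ENNReal.ofReal t * T < ⨆ x, g x := by
      rw [← hT]
      calc ENNReal.ofReal t * T < 1 * T := by
            rw [ENNReal.mul_lt_mul_iff_left hT0 hgb]; simpa using ht
        _ = T := one_mul _
    obtain ⟨x, hx⟩ := lt_iSup_iff.1 this
    refine ⟨x, (lt_iff (hGt x) h0).2 ?_⟩
    rwa [ENNReal.lt_div_iff_mul_lt (.inl hT0) (.inl hgb)]
  · intro t ht0 ht1 x y hx hy
    rw [lt_iff (hFt x) ht0.le, ENNReal.lt_div_iff_mul_lt (.inl hS0) (.inl hfb)] at hx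
    rw [lt_iff (hGt y) ht0.le, ENNReal.lt_div_iff_mul_lt (.inl hT0) (.inl hgb)] at hy
    rw [lt_iff (hHt _) ht0.le, lt_min_iff]
    refine ⟨?_, by simpa using ht1⟩
    rw [ENNReal.lt_div_iff_mul_lt (.inl hc0) (.inl hct)]
    refine lt_of_lt_of_le ?_ (hfgh x y)
    calc ENNReal.ofReal t * c
        = (ENNReal.ofReal t * S) ^ θ * (ENNReal.ofReal t * T) ^ (1 - θ) := by
          rw [ENNReal.mul_rpow_of_nonneg _ _ hθ.le, ENNReal.mul_rpow_of_nonneg _ _ h1.le,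
            mul_mul_mul_comm, ← ENNReal.rpow_add_of_nonneg _ _ hθ.le h1.le]
          simp [hc]
      _ < f x ^ θ * g y ^ (1 - θ) :=
          ENNReal.mul_lt_mul (ENNReal.rpow_lt_rpow hx hθ) (ENNReal.rpow_lt_rpow hy h1)

/-- The one-dimensional Prékopa–Leindler inequality. -/
theorem prekopaLeindler_real {f g h : ℝ → ENNReal} (hf : Measurable f) (hg : Measurable g)
    (hh : Measurable h) {θ : ℝ} (hθ : 0 < θ) (hθ1 : θ < 1)
    (hfgh : ∀ x y, f x ^ θ * g y ^ (1 - θ) ≤ h (θ * x + (1 - θ) * y)) :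
    (∫⁻ x, f x) ^ θ * (∫⁻ x, g x) ^ (1 - θ) ≤ ∫⁻ x, h x := by
  have h1 : 0 < 1 - θ := sub_pos.2 hθ1
  have trunc : ∀ (a : ℝ → ENNReal), Measurable a →
      Filter.Tendsto (fun n : ℕ => ∫⁻ x, min (a x) n) Filter.atTop (nhds (∫⁻ x, a x)) := by
    intro a ha
    refine lintegral_tendsto_of_tendsto_of_monotone
      (fun n => (ha.min measurable_const).aemeasurable)
      (.of_forall fun x m n hmn => by dsimp only; gcongr) (.of_forall fun x => ?_)
    have := (tendsto_const_nhds (x := a x)).min ENNReal.tendsto_nat_nhds_top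
    simpa using this
  have hmain : ∀ n : ℕ, (∫⁻ x, min (f x) n) ^ θ * (∫⁻ x, min (g x) n) ^ (1 - θ) ≤ ∫⁻ x, h x := by
    intro n
    refine prekopaLeindler_real_bounded (hf.min measurable_const) (hg.min measurable_const) hh hθ
      hθ1 (ne_top_of_le_ne_top (ENNReal.natCast_ne_top n) (iSup_le fun x => min_le_right _ _))
      (ne_top_of_le_ne_top (ENNReal.natCast_ne_top n) (iSup_le fun x => min_le_right _ _)) ?_
    intro x y
    refine le_trans ?_ (hfgh x y)
    gcongr <;> exact min_le_left _ _
  have tf := ((ENNReal.continuous_rpow_const (y := θ)).tendsto _).comp (trunc f hf)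
  have tg := ((ENNReal.continuous_rpow_const (y := 1 - θ)).tendsto _).comp (trunc g hg)
  -- Multiplication on `ENNReal` is discontinuous at `(0, ∞)`, so zero integrals are removed before
  -- passing to the limit.
  by_cases hf0 : ∫⁻ x, f x = 0
  · simp [hf0, hθ]
  by_cases hg0 : ∫⁻ x, g x = 0
  · simp [hg0, h1]
  refine le_of_tendsto (ENNReal.Tendsto.mul tf ?_ tg ?_) (.of_forall hmain)
  · left; simp [ENNReal.rpow_eq_zero_iff, hf0, hθ.not_gt]
  · left; simp [ENNReal.rpow_eq_zero_iff, hg0, hθ1.le]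

/-- The Prékopa–Leindler inequality on `Fin n → ℝ`. -/
theorem prekopaLeindler_pi {θ : ℝ} (hθ : 0 < θ) (hθ1 : θ < 1) (n : ℕ) :
    ∀ {f g h : (Fin n → ℝ) → ENNReal}, Measurable f → Measurable g → Measurable h →
    (∀ x y, f x ^ θ * g y ^ (1 - θ) ≤ h (θ • x + (1 - θ) • y)) →
    (∫⁻ x, f x) ^ θ * (∫⁻ x, g x) ^ (1 - θ) ≤ ∫⁻ x, h x := by
  induction n with
  | zero =>
    intro f g h hf hg hh hfgh
    have : ∀ a : (Fin 0 → ℝ) → ENNReal, ∫⁻ x, a x = a default := by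
      intro a
      rw [lintegral_unique]
      simp only [volume_pi, Measure.pi_univ, Finset.univ_eq_empty, Finset.prod_empty, mul_one]
      exact congrArg a (Subsingleton.elim _ _)
    simp only [this]
    convert hfgh default default
  | succ n ih =>
    intro f g h hf hg hh hfgh
    let e := (MeasurableEquiv.piFinSuccAbove (fun _ : Fin (n + 1) => ℝ) 0).symm
    have he : MeasurePreserving e :=
      (volume_preserving_piFinSuccAbove (fun _ : Fin (n + 1) => ℝ) 0).symm _
    have hint : ∀ a : (Fin (n + 1) → ℝ) → ENNReal, Measurable a →
        ∫⁻ x, a x = ∫⁻ s : ℝ, ∫⁻ v : Fin n → ℝ, a (e (s, v)) := by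
      intro a ha
      rw [← he.lintegral_comp ha, Measure.volume_eq_prod]
      exact lintegral_prod (fun x => a (e x)) (ha.comp e.measurable).aemeasurable
    have hmeas : ∀ a : (Fin (n + 1) → ℝ) → ENNReal, Measurable a →
        Measurable fun s : ℝ => ∫⁻ v : Fin n → ℝ, a (e (s, v)) := fun a ha =>
      (ha.comp e.measurable).lintegral_prod_right'
    rw [hint f hf, hint g hg, hint h hh]
    -- Induction by Fubini: for fixed first coordinates `s`, `t` the slices satisfy the hypothesis
    -- in dimension `n`, whose conclusion is the one-dimensional hypothesis for the slice integrals.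
    refine prekopaLeindler_real (hmeas f hf) (hmeas g hg) (hmeas h hh) hθ hθ1 ?_
    intro s t
    have hsec : ∀ (a : (Fin (n + 1) → ℝ) → ENNReal), Measurable a → ∀ s : ℝ,
        Measurable fun v : Fin n → ℝ => a (e (s, v)) := fun a ha s =>
      ha.comp (e.measurable.comp measurable_prodMk_left)
    refine ih (hsec f hf s) (hsec g hg t) (hsec h hh _) ?_
    intro v w
    convert hfgh (e (s, v)) (e (t, w)) using 2
    ext i
    refine Fin.cases ?_ (fun j => ?_) i <;>
      simp [e, MeasurableEquiv.piFinSuccAbove, Fin.insertNthEquiv]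

/-- The **Prékopa–Leindler inequality** on Euclidean space. -/
theorem prekopaLeindler {d : ℕ} {θ : ℝ} (hθ : 0 < θ) (hθ1 : θ < 1)
    {f g h : EuclideanSpace ℝ (Fin d) → ENNReal} (hf : Measurable f) (hg : Measurable g)
    (hh : Measurable h) (hfgh : ∀ x y, f x ^ θ * g y ^ (1 - θ) ≤ h (θ • x + (1 - θ) • y)) :
    (∫⁻ x, f x) ^ θ * (∫⁻ x, g x) ^ (1 - θ) ≤ ∫⁻ x, h x := by
  have he := PiLp.volume_preserving_toLp (Fin d)
  rw [← he.lintegral_comp hf, ← he.lintegral_comp hg, ← he.lintegral_comp hh]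
  refine prekopaLeindler_pi hθ hθ1 d (hf.comp he.measurable) (hg.comp he.measurable)
    (hh.comp he.measurable) ?_
  intro x y
  exact hfgh _ _

/-! ### Log-concave functions and densities. -/

/-- The multiplicative form hides the value `+∞`: it corresponds to `g = 0`, and since `0 < θ < 1`
the left side vanishes as soon as one endpoint value does. -/
theorem isLogConcave_iff {d : ℕ} {g : EuclideanSpace ℝ (Fin d) → ℝ} :
    IsLogConcave g ↔ (∀ x, 0 ≤ g x) ∧ ∀ x y : EuclideanSpace ℝ (Fin d), ∀ θ : ℝ, 0 < θ → θ < 1 →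
      g x ^ θ * g y ^ (1 - θ) ≤ g (θ • x + (1 - θ) • y) := by
  constructor
  · rintro ⟨φ, hbot, hconv, hg⟩
    refine ⟨fun x => hg x ▸ ENNReal.toReal_nonneg, fun x y θ h0 h1 => ?_⟩
    have h1' : 0 < 1 - θ := sub_pos.2 h1
    have hnn : 0 ≤ g (θ • x + (1 - θ) • y) := hg _ ▸ ENNReal.toReal_nonneg
    rcases eq_or_ne (φ x) ⊤ with hx | hx
    · rw [hg x, hx]; simpa [Real.zero_rpow h0.ne'] using hnn
    rcases eq_or_ne (φ y) ⊤ with hy | hy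
    · rw [hg y, hy]; simpa [Real.zero_rpow h1'.ne'] using hnn
    have hc := hconv x y θ h0 h1
    have hval : ∀ w, φ w ≠ ⊤ → g w = Real.exp (-(φ w).toReal) := by
      intro w hw
      rw [hg w]
      conv_lhs => rw [← EReal.coe_toReal hw (hbot w)]
      rw [← EReal.coe_neg, EReal.exp_coe, ENNReal.toReal_ofReal (Real.exp_pos _).le]
    rw [← EReal.coe_toReal hx (hbot x), ← EReal.coe_toReal hy (hbot y)] at hc
    have hct : φ (θ • x + (1 - θ) • y) ≠ ⊤ := by
      refine ne_top_of_le_ne_top ?_ hc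
      rw [← EReal.coe_mul, ← EReal.coe_mul, ← EReal.coe_add]
      exact EReal.coe_ne_top _
    rw [← EReal.coe_toReal hct (hbot _)] at hc
    norm_cast at hc
    rw [hval x hx, hval y hy, hval _ hct, ← Real.exp_mul, ← Real.exp_mul, ← Real.exp_add]
    apply Real.exp_le_exp.2
    linarith
  · rintro ⟨h0, hc⟩
    refine ⟨fun x => if g x = 0 then ⊤ else ((-Real.log (g x) : ℝ) : EReal), ?_, ?_, ?_⟩
    · intro x
      dsimp only
      split_ifs
      · simp
      · exact EReal.coe_ne_bot _
    · intro x y θ hθ0 hθ1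
      have h1' : 0 < 1 - θ := sub_pos.2 hθ1
      by_cases hx : g x = 0
      · have : (θ : EReal) * ⊤ = ⊤ := EReal.coe_mul_top_of_pos hθ0
        simp only [hx, if_true, this]
        rw [EReal.top_add_of_ne_bot]
        · exact le_top
        · split_ifs
          · rw [EReal.coe_mul_top_of_pos h1']; simp
          · rw [← EReal.coe_mul]; exact EReal.coe_ne_bot _
      by_cases hy : g y = 0
      · have : ((1 - θ : ℝ) : EReal) * ⊤ = ⊤ := EReal.coe_mul_top_of_pos h1'
        simp only [hx, hy, if_true, if_false, this]
        rw [← EReal.coe_mul, EReal.add_top_of_ne_bot (EReal.coe_ne_bot _)]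
        exact le_top
      have hx' : 0 < g x := (h0 x).lt_of_ne' hx
      have hy' : 0 < g y := (h0 y).lt_of_ne' hy
      have hpos : 0 < g x ^ θ * g y ^ (1 - θ) :=
        mul_pos (Real.rpow_pos_of_pos hx' _) (Real.rpow_pos_of_pos hy' _)
      have hcc := hc x y θ hθ0 hθ1
      have hcp : g (θ • x + (1 - θ) • y) ≠ 0 := (hpos.trans_le hcc).ne'
      simp only [hx, hy, hcp, if_false]
      norm_cast
      have := Real.log_le_log hpos hcc
      rw [Real.log_mul (Real.rpow_pos_of_pos hx' _).ne' (Real.rpow_pos_of_pos hy' _).ne',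
        Real.log_rpow hx', Real.log_rpow hy'] at this
      linarith
    · intro x
      dsimp only
      split_ifs with hx
      · simp [hx]
      · rw [← EReal.coe_neg, EReal.exp_coe, neg_neg, Real.exp_log ((h0 x).lt_of_ne' hx),
          ENNReal.toReal_ofReal (h0 x)]

theorem IsLogConcave.nonneg {d : ℕ} {g : EuclideanSpace ℝ (Fin d) → ℝ} (hg : IsLogConcave g)
    (x : EuclideanSpace ℝ (Fin d)) : 0 ≤ g x := (isLogConcave_iff.1 hg).1 x

theorem IsLogConcave.rpow_mul_rpow_le {d : ℕ} {g : EuclideanSpace ℝ (Fin d) → ℝ}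
    (hg : IsLogConcave g) (x y : EuclideanSpace ℝ (Fin d)) {θ : ℝ} (h0 : 0 < θ) (h1 : θ < 1) :
    g x ^ θ * g y ^ (1 - θ) ≤ g (θ • x + (1 - θ) • y) := (isLogConcave_iff.1 hg).2 x y θ h0 h1

theorem IsLogConcave.mul {d : ℕ} {f g : EuclideanSpace ℝ (Fin d) → ℝ}
    (hf : IsLogConcave f) (hg : IsLogConcave g) : IsLogConcave (fun x => f x * g x) := by
  refine isLogConcave_iff.2 ⟨fun x => mul_nonneg (hf.nonneg x) (hg.nonneg x), ?_⟩
  intro x y θ h0 h1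
  rw [Real.mul_rpow (hf.nonneg x) (hg.nonneg x), Real.mul_rpow (hf.nonneg y) (hg.nonneg y),
    mul_mul_mul_comm]
  exact mul_le_mul (hf.rpow_mul_rpow_le x y h0 h1) (hg.rpow_mul_rpow_le x y h0 h1)
    (mul_nonneg (Real.rpow_nonneg (hg.nonneg _) _) (Real.rpow_nonneg (hg.nonneg _) _))
    (hf.nonneg _)

theorem norm_sq_combo_le {E : Type*} [NormedAddCommGroup E] [InnerProductSpace ℝ E] (x y : E)
    {θ : ℝ} (h0 : 0 < θ) (h1 : θ < 1) :
    ‖θ • x + (1 - θ) • y‖ ^ 2 ≤ θ * ‖x‖ ^ 2 + (1 - θ) * ‖y‖ ^ 2 := by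
  have h1' : 0 < 1 - θ := sub_pos.2 h1
  have h2 : ‖x - y‖ ^ 2 = ‖x‖ ^ 2 - 2 * inner ℝ x y + ‖y‖ ^ 2 := norm_sub_sq_real x y
  have h3 : ‖θ • x + (1 - θ) • y‖ ^ 2
      = ‖θ • x‖ ^ 2 + 2 * inner ℝ (θ • x) ((1 - θ) • y) + ‖(1 - θ) • y‖ ^ 2 :=
    norm_add_sq_real _ _
  rw [norm_smul, norm_smul, inner_smul_left, inner_smul_right, Real.norm_of_nonneg h0.le,
    Real.norm_of_nonneg h1'.le] at h3
  simp only [conj_trivial] at h3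
  have h4 := mul_nonneg (mul_nonneg h0.le h1'.le) (sq_nonneg ‖x - y‖)
  rw [h2] at h4
  rw [h3]
  linarith

theorem gaussianDensity_pos (d : ℕ) {v : ℝ} (hv : 0 < v) (x : EuclideanSpace ℝ (Fin d)) :
    0 < gaussianDensity d v x := by
  unfold gaussianDensity
  positivity

theorem exp_neg_combo_le {E : Type*} [NormedAddCommGroup E] [InnerProductSpace ℝ E] {c : ℝ}
    (hc : 0 ≤ c) (x y : E) {θ : ℝ} (h0 : 0 < θ) (h1 : θ < 1) :
    Real.exp (-(c * ‖x‖ ^ 2)) ^ θ * Real.exp (-(c * ‖y‖ ^ 2)) ^ (1 - θ)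
      ≤ Real.exp (-(c * ‖θ • x + (1 - θ) • y‖ ^ 2)) := by
  rw [← Real.exp_mul, ← Real.exp_mul, ← Real.exp_add]
  apply Real.exp_le_exp.2
  nlinarith [mul_le_mul_of_nonneg_left (norm_sq_combo_le x y h0 h1) hc]

theorem const_rpow_mul_rpow {c : ℝ} (hc : 0 < c) (θ : ℝ) : c ^ θ * c ^ (1 - θ) = c := by
  rw [← Real.rpow_add hc]; simp

theorem isLogConcave_gaussianDensity (d : ℕ) {v : ℝ} (hv : 0 < v) :
    IsLogConcave (gaussianDensity d v) := by
  refine isLogConcave_iff.2 ⟨fun x => (gaussianDensity_pos d hv x).le, fun x y θ h0 h1 => ?_⟩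
  unfold gaussianDensity
  have hC : 0 < (2 * Real.pi * v) ^ (-(d : ℝ) / 2) := by positivity
  have he : ∀ w : EuclideanSpace ℝ (Fin d), -‖w‖ ^ 2 / (2 * v) = -((2 * v)⁻¹ * ‖w‖ ^ 2) := by
    intro w; rw [neg_div, div_eq_inv_mul]
  simp only [he]
  rw [Real.mul_rpow hC.le (Real.exp_pos _).le, Real.mul_rpow hC.le (Real.exp_pos _).le,
    mul_mul_mul_comm, const_rpow_mul_rpow hC]
  gcongr
  exact exp_neg_combo_le (by positivity) x y h0 h1

theorem isLogConcave_of_mem_SLC1 {d : ℕ} {v : ℝ} (hv : 0 < v) {p : EuclideanSpace ℝ (Fin d) → ℝ}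
    (hp : p ∈ SLC1 v d) : IsLogConcave p := by
  obtain ⟨-, g, hg, hpg⟩ := hp
  rw [funext hpg]
  exact hg.mul (isLogConcave_gaussianDensity d hv)

theorem IsDensity.lintegral_eq_one {d : ℕ} {p : EuclideanSpace ℝ (Fin d) → ℝ} (hp : IsDensity p) :
    ∫⁻ x, ENNReal.ofReal (p x) = 1 := by
  rw [← ofReal_integral_eq_lintegral_ofReal hp.integrable (.of_forall hp.nonneg),
    hp.integral_eq_one, ENNReal.ofReal_one]

open Pointwise in
/-- A log-concave density is bounded. -/
theorem IsLogConcave.exists_le_of_isDensity {d : ℕ} {p : EuclideanSpace ℝ (Fin d) → ℝ}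
    (hlc : IsLogConcave p) (hp : IsDensity p) : ∃ C, ∀ x, p x ≤ C := by
  -- Let `A` be a superlevel set `{p > ε}` of positive measure. By log-concavity `p ≥ √(p x ε)` on
  -- `x/2 + A/2`, whose volume `c` does not depend on `x`. As the total mass is `1`, `√(p x ε) ≤
  -- 1/c`.
  obtain ⟨ε, hε, hA⟩ : ∃ ε : ℝ, 0 < ε ∧ volume {x | ε < p x} ≠ 0 := by
    by_contra! hcon
    have : volume {x | 0 < p x} = 0 := by
      have : {x | 0 < p x} = ⋃ n : ℕ, {x | 1 / ((n : ℝ) + 1) < p x} := by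
        ext x
        simp only [Set.mem_ofPred_eq, Set.mem_iUnion]
        exact ⟨fun h => exists_nat_one_div_lt h, fun ⟨n, hn⟩ => lt_trans (by positivity) hn⟩
      rw [this, measure_iUnion_null_iff]
      exact fun n => hcon _ (by positivity)
    have h0 : p =ᵐ[volume] 0 := by
      rw [Filter.EventuallyEq, ae_iff]
      convert this using 2
      ext x
      exact ⟨fun h => (hp.nonneg x).lt_of_ne' h, fun h => h.ne'⟩
    have := hp.integral_eq_one
    rw [integral_congr_ae h0] at this
    simp at this
  set A := {x | ε < p x} with hAdef
  set c := volume ((1 / 2 : ℝ) • A) with hc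
  have hc0 : c ≠ 0 := by
    rw [hc, Measure.addHaar_smul]
    exact mul_ne_zero (by simp) hA
  refine ⟨(c⁻¹).toReal ^ 2 / ε, fun x => ?_⟩
  have hx := hp.nonneg x
  rw [le_div_iff₀ hε]
  have hsub : (1 / 2 : ℝ) • x +ᵥ (1 / 2 : ℝ) • A
      ⊆ {y | ENNReal.ofReal (Real.sqrt (p x * ε)) ≤ ENNReal.ofReal (p y)} := by
    rintro _ ⟨_, ⟨y, hy, rfl⟩, rfl⟩
    apply ENNReal.ofReal_le_ofReal
    have := hlc.rpow_mul_rpow_le x y (θ := 1 / 2) (by norm_num) (by norm_num)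
    norm_num at this
    simp only [vadd_eq_add]
    norm_num
    refine le_trans ?_ this
    rw [Real.sqrt_eq_rpow, Real.mul_rpow hx hε.le]
    norm_num
    gcongr
    exact le_of_lt hy
  have h1 : ENNReal.ofReal (Real.sqrt (p x * ε)) * c ≤ 1 := by
    rw [← hp.lintegral_eq_one]
    refine le_trans ?_ (mul_meas_ge_le_lintegral hp.measurable.ennreal_ofReal
      (ENNReal.ofReal (Real.sqrt (p x * ε))))
    gcongr
    rw [hc, ← measure_vadd volume ((1 / 2 : ℝ) • x)]
    exact measure_mono hsub
  have h2 : ENNReal.ofReal (Real.sqrt (p x * ε)) ≤ c⁻¹ := by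
    rw [ENNReal.le_inv_iff_mul_le]; exact h1
  have h3 : Real.sqrt (p x * ε) ≤ (c⁻¹).toReal :=
    (ENNReal.ofReal_le_iff_le_toReal (ENNReal.inv_ne_top.2 hc0)).1 h2
  calc p x * ε = Real.sqrt (p x * ε) ^ 2 := (Real.sq_sqrt (by positivity)).symm
    _ ≤ _ := by gcongr

/-! ### The convolution as a density, and preservation of strong log-concavity. -/

theorem conv_apply {d : ℕ} (p q : EuclideanSpace ℝ (Fin d) → ℝ) (z : EuclideanSpace ℝ (Fin d)) :
    conv p q z = ∫ x, p x * q (z - x) := rfl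

theorem measurable_conv {d : ℕ} {p q : EuclideanSpace ℝ (Fin d) → ℝ} (hp : Measurable p)
    (hq : Measurable q) : Measurable (conv p q) := by
  have h : Measurable fun w : EuclideanSpace ℝ (Fin d) × EuclideanSpace ℝ (Fin d) =>
      p w.2 * q (w.1 - w.2) := by fun_prop
  exact h.stronglyMeasurable.integral_prod_right.measurable

theorem isDensity_conv {d : ℕ} {p q : EuclideanSpace ℝ (Fin d) → ℝ} (hp : IsDensity p)
    (hq : IsDensity q) : IsDensity (conv p q) where
  measurable := measurable_conv hp.measurable hq.measurable
  nonneg z := integral_nonneg fun x => mul_nonneg (hp.nonneg x) (hq.nonneg _)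
  integrable := hp.integrable.integrable_convolution _ hq.integrable
  integral_eq_one := by
    have := integral_convolution (ContinuousLinearMap.mul ℝ ℝ) hp.integrable hq.integrable
    rw [hp.integral_eq_one, hq.integral_eq_one] at this
    refine Eq.trans this ?_
    simp

theorem hasDensity_add {d : ℕ} {Ω : Type*} [MeasurableSpace Ω] {P : Measure Ω}
    [IsProbabilityMeasure P] {X Y : Ω → EuclideanSpace ℝ (Fin d)} (hX : Measurable X)
    (hY : Measurable Y) (hXY : IndepFun X Y P) {p q : EuclideanSpace ℝ (Fin d) → ℝ}
    (hp : IsDensity p) (hq : IsDensity q) (hXp : HasDensity P X p) (hYq : HasDensity P Y q)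
    (hint : ∀ z, Integrable (fun x => p x * q (z - x)) volume) :
    HasDensity P (fun ω => X ω + Y ω) (conv p q) := by
  unfold HasDensity at *
  have := hXY.map_add_eq_map_conv_map hX hY
  rw [hXp, hYq] at this
  rw [show (fun ω => X ω + Y ω) = X + Y from rfl, this,
    conv_withDensity_eq_lconvolution hp.measurable.ennreal_ofReal hq.measurable.ennreal_ofReal]
  congr 1
  ext z
  rw [lconvolution_def, conv_apply, ofReal_integral_eq_lintegral_ofReal (hint z)
    (.of_forall fun x => mul_nonneg (hp.nonneg x) (hq.nonneg _))]
  refine lintegral_congr fun x => ?_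
  rw [ENNReal.ofReal_mul (hp.nonneg x), neg_add_eq_sub]

/-- Completing the square: up to a constant, the exponent is minus the square of the norm of a
linear function of `(x, z)`, hence jointly concave. -/
theorem gaussianDensity_mul_div {d : ℕ} {v w : ℝ} (hv : 0 < v) (hw : 0 < w)
    (x z : EuclideanSpace ℝ (Fin d)) :
    gaussianDensity d v x * gaussianDensity d w (z - x) / gaussianDensity d (v + w) z =
      (2 * Real.pi * v) ^ (-(d : ℝ) / 2) * (2 * Real.pi * w) ^ (-(d : ℝ) / 2)
        / (2 * Real.pi * (v + w)) ^ (-(d : ℝ) / 2)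
        * Real.exp (-((v + w) / (2 * v * w) * ‖x - (v / (v + w)) • z‖ ^ 2)) := by
  unfold gaussianDensity
  have hvw : 0 < v + w := add_pos hv hw
  rw [mul_mul_mul_comm, mul_div_mul_comm, ← Real.exp_add, ← Real.exp_sub]
  congr 2
  rw [norm_sub_sq_real, norm_sub_sq_real, norm_smul, inner_smul_right, real_inner_comm z x,
    Real.norm_of_nonneg (by positivity)]
  field_simp
  ring

/-- Strong log-concavity is preserved by convolution. -/
theorem conv_mem_SLC1 {d : ℕ} {v w : ℝ} (hv : 0 < v) (hw : 0 < w)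
    {p q : EuclideanSpace ℝ (Fin d) → ℝ} (hp : p ∈ SLC1 v d) (hq : q ∈ SLC1 w d)
    (hint : ∀ z, Integrable (fun x => p x * q (z - x)) volume) :
    conv p q ∈ SLC1 (v + w) d := by
  obtain ⟨hpd, f, hf, hpf⟩ := hp
  obtain ⟨hqd, g, hg, hqg⟩ := hq
  have hvw : 0 < v + w := add_pos hv hw
  have hγ := gaussianDensity_pos d hvw
  have hdens := isDensity_conv hpd hqd
  refine ⟨hdens, fun z => conv p q z / gaussianDensity d (v + w) z, ?_,
    fun z => (div_mul_cancel₀ _ (hγ z).ne').symm⟩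
  refine isLogConcave_iff.2 ⟨fun z => div_nonneg (hdens.nonneg z) (hγ z).le, ?_⟩
  intro z₁ z₂ θ h0 h1
  have h1' : 0 < 1 - θ := sub_pos.2 h1
  set F : EuclideanSpace ℝ (Fin d) → EuclideanSpace ℝ (Fin d) → ℝ := fun z x =>
    p x * q (z - x) / gaussianDensity d (v + w) z with hF
  have hF0 : ∀ z x, 0 ≤ F z x := fun z x =>
    div_nonneg (mul_nonneg (hpd.nonneg x) (hqd.nonneg _)) (hγ z).le
  have hFm : ∀ z, Measurable (F z) := fun z => by
    have := hpd.measurable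
    have := hqd.measurable
    fun_prop
  set C := (2 * Real.pi * v) ^ (-(d : ℝ) / 2) * (2 * Real.pi * w) ^ (-(d : ℝ) / 2)
        / (2 * Real.pi * (v + w)) ^ (-(d : ℝ) / 2) with hC
  have hCpos : 0 < C := by positivity
  have hFeq : ∀ z x, F z x = C * (f x * g (z - x)
      * Real.exp (-((v + w) / (2 * v * w) * ‖x - (v / (v + w)) • z‖ ^ 2))) := by
    intro z x
    simp only [hF, hpf, hqg]
    rw [mul_mul_mul_comm, mul_div_assoc, gaussianDensity_mul_div hv hw]
    ring
  have hFint : ∀ z, ∫⁻ x, ENNReal.ofReal (F z x)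
      = ENNReal.ofReal (conv p q z / gaussianDensity d (v + w) z) := by
    intro z
    rw [conv_apply, ← integral_div, ofReal_integral_eq_lintegral_ofReal
      ((hint z).div_const _) (.of_forall (hF0 z))]
  -- Prékopa–Leindler in `x` for the sections of `F` at `z₁`, `z₂` and their combination; the goal
  -- left over is the joint log-concavity of `F`.
  have key := prekopaLeindler h0 h1 (hFm z₁).ennreal_ofReal (hFm z₂).ennreal_ofReal
    (hFm (θ • z₁ + (1 - θ) • z₂)).ennreal_ofReal ?_
  · simp only [hFint] at key
    rw [ENNReal.ofReal_rpow_of_nonneg (div_nonneg (hdens.nonneg _) (hγ _).le) h0.le,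
      ENNReal.ofReal_rpow_of_nonneg (div_nonneg (hdens.nonneg _) (hγ _).le) h1'.le,
      ← ENNReal.ofReal_mul (Real.rpow_nonneg (div_nonneg (hdens.nonneg _) (hγ _).le) _)] at key
    exact (ENNReal.ofReal_le_ofReal_iff (div_nonneg (hdens.nonneg _) (hγ _).le)).1 key
  · intro x y
    rw [ENNReal.ofReal_rpow_of_nonneg (hF0 _ _) h0.le,
      ENNReal.ofReal_rpow_of_nonneg (hF0 _ _) h1'.le,
      ← ENNReal.ofReal_mul (Real.rpow_nonneg (hF0 _ _) _)]
    apply ENNReal.ofReal_le_ofReal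
    simp only [hFeq]
    have a1 := hf.nonneg
    have a2 := hg.nonneg
    rw [Real.mul_rpow hCpos.le (mul_nonneg (mul_nonneg (a1 _) (a2 _)) (Real.exp_pos _).le),
      Real.mul_rpow hCpos.le (mul_nonneg (mul_nonneg (a1 _) (a2 _)) (Real.exp_pos _).le),
      mul_mul_mul_comm, const_rpow_mul_rpow hCpos,
      Real.mul_rpow (mul_nonneg (a1 _) (a2 _)) (Real.exp_pos _).le,
      Real.mul_rpow (mul_nonneg (a1 _) (a2 _)) (Real.exp_pos _).le,
      Real.mul_rpow (a1 _) (a2 _), Real.mul_rpow (a1 _) (a2 _), mul_mul_mul_comm,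
      mul_mul_mul_comm (f x ^ θ)]
    have e1 : θ • z₁ + (1 - θ) • z₂ - (θ • x + (1 - θ) • y)
        = θ • (z₁ - x) + (1 - θ) • (z₂ - y) := by module
    have e2 : θ • x + (1 - θ) • y - (v / (v + w)) • (θ • z₁ + (1 - θ) • z₂)
        = θ • (x - (v / (v + w)) • z₁) + (1 - θ) • (y - (v / (v + w)) • z₂) := by module
    rw [e1, e2]
    have b1 := hf.rpow_mul_rpow_le x y h0 h1
    have b2 := hg.rpow_mul_rpow_le (z₁ - x) (z₂ - y) h0 h1
    have b3 := exp_neg_combo_le (c := (v + w) / (2 * v * w)) (by positivity)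
      (x - (v / (v + w)) • z₁) (y - (v / (v + w)) • z₂) h0 h1
    refine mul_le_mul_of_nonneg_left (mul_le_mul (mul_le_mul b1 b2 ?_ (a1 _)) b3 ?_ ?_) hCpos.le
    · exact mul_nonneg (Real.rpow_nonneg (a2 _) _) (Real.rpow_nonneg (a2 _) _)
    · positivity
    · exact mul_nonneg (a1 _) (a2 _)

/-! ### Continuity and differentiation of convolutions in `L²`. -/

section LTwoConvolution

variable {d : ℕ} {F : Type*} [NormedAddCommGroup F]

theorem measurePreserving_const_sub (z : EuclideanSpace ℝ (Fin d)) :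
    MeasurePreserving (fun x : EuclideanSpace ℝ (Fin d) => z - x) volume volume :=
  Measure.measurePreserving_sub_left volume z

theorem MeasureTheory.MemLp.comp_const_sub {p : ENNReal} {h : EuclideanSpace ℝ (Fin d) → F}
    (hh : MemLp h p volume) (z : EuclideanSpace ℝ (Fin d)) :
    MemLp (fun x => h (z - x)) p volume :=
  hh.comp_measurePreserving (measurePreserving_const_sub z)

variable [NormedSpace ℝ F]

theorem integrable_smul_comp_sub {f : EuclideanSpace ℝ (Fin d) → ℝ}
    {h : EuclideanSpace ℝ (Fin d) → F} (hf : MemLp f 2 volume) (hh : MemLp h 2 volume)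
    (z : EuclideanSpace ℝ (Fin d)) : Integrable (fun x => f x • h (z - x)) volume :=
  memLp_one_iff_integrable.1 ((hh.comp_const_sub z).smul hf)

theorem enorm_integral_smul_comp_sub_le {f : EuclideanSpace ℝ (Fin d) → ℝ}
    {h : EuclideanSpace ℝ (Fin d) → F} (hf : MemLp f 2 volume) (hh : MemLp h 2 volume)
    (z : EuclideanSpace ℝ (Fin d)) :
    ‖∫ x, f x • h (z - x)‖ₑ ≤ eLpNorm f 2 volume * eLpNorm h 2 volume := by
  calc ‖∫ x, f x • h (z - x)‖ₑ ≤ ∫⁻ x, ‖f x • h (z - x)‖ₑ := enorm_integral_le_lintegral_enorm _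
    _ = eLpNorm (f • fun x => h (z - x)) 1 volume := by
      rw [eLpNorm_one_eq_lintegral_enorm]; rfl
    _ ≤ eLpNorm f 2 volume * eLpNorm (fun x => h (z - x)) 2 volume :=
      eLpNorm_smul_le_mul_eLpNorm (hh.comp_const_sub z).1 hf.1
    _ = _ := by
      rw [← eLpNorm_comp_measurePreserving hh.1 (measurePreserving_const_sub z)]; rfl

/-- The convolution of two square integrable functions is continuous. -/
theorem continuous_integral_smul_comp_sub {f : EuclideanSpace ℝ (Fin d) → ℝ}
    {h : EuclideanSpace ℝ (Fin d) → F} (hf : MemLp f 2 volume) (hh : MemLp h 2 volume) :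
    Continuous fun z => ∫ x, f x • h (z - x) := by
  refine continuous_of_uniform_approx_of_continuous fun u hu => ?_
  -- Approximate `f` in `L²` by continuous compactly supported `g`. By Cauchy–Schwarz the
  -- convolutions differ by at most `δ K < ε`, uniformly in `z`.
  obtain ⟨ε, hε, hu⟩ := Metric.mem_uniformity_dist.1 hu
  set K := (eLpNorm h 2 volume).toReal with hK
  have hK0 : 0 ≤ K := ENNReal.toReal_nonneg
  set δ := ε / (K + 1) / 2 with hδ
  have hδ0 : 0 < δ := by positivity
  obtain ⟨g, hgc, hgle, hg, hgm⟩ := hf.exists_hasCompactSupport_eLpNorm_sub_le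
    (by norm_num) (ε := ENNReal.ofReal δ) (by simpa using hδ0)
  refine ⟨fun z => ∫ x, g x • h (z - x), ?_, fun z => hu ?_⟩
  · exact hgc.continuous_convolution_left (L := ContinuousLinearMap.lsmul ℝ ℝ) hg
      (hh.locallyIntegrable (by norm_num))
  · rw [dist_eq_norm, ← integral_sub (integrable_smul_comp_sub hf hh z)
      (integrable_smul_comp_sub hgm hh z)]
    simp only [← sub_smul]
    have h1 := enorm_integral_smul_comp_sub_le (hf.sub hgm) hh z
    have h2 : eLpNorm (f - g) 2 volume * eLpNorm h 2 volume ≤ ENNReal.ofReal (δ * K) := by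
      rw [ENNReal.ofReal_mul hδ0.le, hK, ENNReal.ofReal_toReal hh.eLpNorm_ne_top]
      gcongr
    have h3 := h1.trans h2
    rw [← ofReal_norm, ENNReal.ofReal_le_ofReal_iff (by positivity)] at h3
    refine lt_of_le_of_lt h3 ?_
    rw [hδ, div_div, div_mul_eq_mul_div, div_lt_iff₀ (by positivity)]
    nlinarith

theorem memLp_clm_apply {p : ENNReal} {A : EuclideanSpace ℝ (Fin d) → EuclideanSpace ℝ (Fin d) →L[ℝ] F}
    (hA : MemLp A p volume) (v : EuclideanSpace ℝ (Fin d)) : MemLp (fun x => A x v) p volume :=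
  (ContinuousLinearMap.apply ℝ F v).comp_memLp' hA

theorem integral_smul_comp_sub_apply {f : EuclideanSpace ℝ (Fin d) → ℝ}
    {A : EuclideanSpace ℝ (Fin d) → EuclideanSpace ℝ (Fin d) →L[ℝ] F} (hf : MemLp f 2 volume)
    (hA : MemLp A 2 volume) (z v : EuclideanSpace ℝ (Fin d)) :
    (∫ x, f x • A (z - x)) v = ∫ x, f x • A (z - x) v := by
  rw [ContinuousLinearMap.integral_apply (integrable_smul_comp_sub hf hA _)]
  simp only [smul_apply]

theorem integrable_prod_smul_comp_sub {f : EuclideanSpace ℝ (Fin d) → ℝ}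
    {k : EuclideanSpace ℝ (Fin d) → F} (hf : MemLp f 2 volume) (hk : Continuous k)
    (hk2 : MemLp k 2 volume) (z v : EuclideanSpace ℝ (Fin d)) :
    Integrable (Function.uncurry fun (t : ℝ) x => f x • k (z + t • v - x))
      ((volume.restrict (Set.uIoc (0 : ℝ) 1)).prod volume) := by
  have h1 : AEStronglyMeasurable (fun w : ℝ × EuclideanSpace ℝ (Fin d) => f w.2)
      ((volume.restrict (Set.uIoc (0 : ℝ) 1)).prod volume) := hf.1.comp_snd
  have h2 : Continuous fun w : ℝ × EuclideanSpace ℝ (Fin d) => k (z + w.1 • v - w.2) :=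
    hk.comp (by fun_prop)
  have h3 : AEStronglyMeasurable (fun w : ℝ × EuclideanSpace ℝ (Fin d) =>
      f w.2 • k (z + w.1 • v - w.2)) ((volume.restrict (Set.uIoc (0 : ℝ) 1)).prod volume) :=
    h1.smul h2.aestronglyMeasurable
  refine (integrable_prod_iff h3).2 ⟨.of_forall fun t => integrable_smul_comp_sub hf hk2 (z + t • v), ?_⟩
  have hcont : Continuous fun t : ℝ => ∫ x, ‖f x • k (z + t • v - x)‖ := by
    have h1 := continuous_integral_smul_comp_sub hf.norm hk2.norm
    have h2 : Continuous fun t : ℝ => z + t • v := by fun_prop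
    simpa [norm_smul, Function.comp_def] using h1.comp h2
  exact hcont.integrableOn_uIcc.mono_set Set.uIoc_subset_uIcc

variable [CompleteSpace F]

theorem sub_eq_intervalIntegral_fderiv {g : EuclideanSpace ℝ (Fin d) → F} (hg : ContDiff ℝ 1 g)
    (z v x : EuclideanSpace ℝ (Fin d)) : g (z + v - x) - g (z - x)
      = ∫ t in (0 : ℝ)..1, fderiv ℝ g (z + t • v - x) v := by
  have hDc : Continuous (fderiv ℝ g) := hg.continuous_fderiv (by norm_num)
  have hd : ∀ t ∈ Set.uIcc (0 : ℝ) 1,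
      HasDerivAt (fun t : ℝ => g (z + t • v - x)) (fderiv ℝ g (z + t • v - x) v) t := by
    intro t _
    have h1 : HasDerivAt (fun t : ℝ => z + t • v - x) v t := by
      simpa using (((hasDerivAt_id t).smul_const v).const_add z).sub_const x
    exact ((hg.differentiable (by norm_num)) _).hasFDerivAt.comp_hasDerivAt t h1
  have hc : Continuous fun t : ℝ => fderiv ℝ g (z + t • v - x) v :=
    (hDc.comp (by fun_prop)).clm_apply continuous_const
  rw [intervalIntegral.integral_eq_sub_of_hasDerivAt hd (hc.intervalIntegrable _ _)]
  simp

/-- The fundamental theorem of calculus along the segment, integrated against `f` by Fubini. It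
replaces differentiation under the integral sign, for which a derivative merely in `L²` offers no
dominating function. -/
theorem integral_smul_sub_eq_intervalIntegral {f : EuclideanSpace ℝ (Fin d) → ℝ}
    {g : EuclideanSpace ℝ (Fin d) → F} (hf : MemLp f 2 volume) (hg : ContDiff ℝ 1 g)
    (hg2 : MemLp g 2 volume) (hDg : MemLp (fderiv ℝ g) 2 volume)
    (z v : EuclideanSpace ℝ (Fin d)) :
    (∫ x, f x • g (z + v - x)) - ∫ x, f x • g (z - x)
      = ∫ t in (0 : ℝ)..1, (∫ x, f x • fderiv ℝ g (z + t • v - x)) v := by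
  have hDc : Continuous (fderiv ℝ g) := hg.continuous_fderiv (by norm_num)
  simp only [integral_smul_comp_sub_apply hf hDg]
  rw [← integral_sub (integrable_smul_comp_sub hf hg2 _) (integrable_smul_comp_sub hf hg2 _)]
  simp only [← smul_sub, sub_eq_intervalIntegral_fderiv hg, ← intervalIntegral.integral_smul]
  exact (intervalIntegral_integral_swap (integrable_prod_smul_comp_sub hf
    (hDc.clm_apply continuous_const) (memLp_clm_apply hDg v) z v)).symm

/-- Differentiation of the convolution of two square integrable functions, the second of which is
continuously differentiable with a square integrable derivative. -/
theorem hasFDerivAt_integral_smul_comp_sub {f : EuclideanSpace ℝ (Fin d) → ℝ}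
    {g : EuclideanSpace ℝ (Fin d) → F} (hf : MemLp f 2 volume) (hg : ContDiff ℝ 1 g)
    (hg2 : MemLp g 2 volume) (hDg : MemLp (fderiv ℝ g) 2 volume)
    (z : EuclideanSpace ℝ (Fin d)) :
    HasFDerivAt (fun z => ∫ x, f x • g (z - x)) (∫ x, f x • fderiv ℝ g (z - x)) z := by
  set H : EuclideanSpace ℝ (Fin d) → EuclideanSpace ℝ (Fin d) →L[ℝ] F :=
    fun z => ∫ x, f x • fderiv ℝ g (z - x) with hH
  have hHc : Continuous H := continuous_integral_smul_comp_sub hf hDg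
  rw [hasFDerivAt_iff_isLittleO_nhds_zero, Asymptotics.isLittleO_iff]
  intro ε hε
  obtain ⟨δ, hδ, hball⟩ := Metric.continuousAt_iff.1 hHc.continuousAt ε hε
  filter_upwards [Metric.ball_mem_nhds (0 : EuclideanSpace ℝ (Fin d)) hδ] with v hv
  rw [mem_ball_zero_iff] at hv
  rw [integral_smul_sub_eq_intervalIntegral hf hg hg2 hDg]
  have hc : Continuous fun t : ℝ => H (z + t • v) v := by fun_prop
  have h1 : (∫ x, f x • fderiv ℝ g (z - x)) v = ∫ t in (0 : ℝ)..1, H z v := by simp [hH]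
  rw [h1, ← intervalIntegral.integral_sub (hc.intervalIntegrable _ _) (by simp)]
  have h2 : ∀ t ∈ Set.uIoc (0 : ℝ) 1, ‖H (z + t • v) v - H z v‖ ≤ ε * ‖v‖ := by
    intro t ht
    rw [Set.uIoc_of_le zero_le_one] at ht
    rw [← sub_apply]
    refine (ContinuousLinearMap.le_opNorm _ _).trans ?_
    gcongr
    rw [← dist_eq_norm]
    refine (hball ?_).le
    rw [dist_eq_norm, add_sub_cancel_left, norm_smul, Real.norm_of_nonneg ht.1.le]
    exact (mul_le_of_le_one_left (norm_nonneg _) ht.2).trans_lt hv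
  simpa using intervalIntegral.norm_integral_le_of_norm_le_const h2

end LTwoConvolution

/-! ### Regular densities: the convolution is twice continuously differentiable. -/

section RegularDensity

variable {d : ℕ} {p q : EuclideanSpace ℝ (Fin d) → ℝ}

theorem IsRegularDensity.eq_exp (hp : IsRegularDensity p) (x : EuclideanSpace ℝ (Fin d)) :
    p x = Real.exp (-potential p x) := by
  rw [potential, neg_neg, Real.exp_log (hp.pos x)]

theorem IsRegularDensity.contDiff_self (hp : IsRegularDensity p) : ContDiff ℝ 2 p := by
  rw [funext hp.eq_exp]
  exact hp.contDiff.neg.exp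

theorem IsRegularDensity.hasFDerivAt (hp : IsRegularDensity p) (x : EuclideanSpace ℝ (Fin d)) :
    HasFDerivAt p (-(p x • fderiv ℝ (potential p) x)) x := by
  have h1 := (hp.contDiff.differentiable (by norm_num) x).hasFDerivAt.neg.exp
  rw [show (fun x => Real.exp ((-potential p) x)) = p from funext fun y => (hp.eq_exp y).symm,
    show Real.exp ((-potential p) x) = p x from (hp.eq_exp x).symm, smul_neg] at h1
  exact h1

theorem IsRegularDensity.norm_fderiv (hp : IsRegularDensity p) (x : EuclideanSpace ℝ (Fin d)) :
    ‖fderiv ℝ p x‖ = p x * ‖gradient (potential p) x‖ := by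
  rw [(hp.hasFDerivAt x).fderiv, norm_neg, norm_smul, Real.norm_of_nonneg (hp.pos x).le, gradient,
    LinearIsometryEquiv.norm_map]

theorem IsDensity.memLp_two (hd : IsDensity p) {C : ℝ}
    (hC : ∀ x, p x ≤ C) : MemLp p 2 volume := by
  refine (memLp_two_iff_integrable_sq hd.measurable.aestronglyMeasurable).2 ?_
  simp only [sq]
  exact hd.integrable.bdd_mul hd.measurable.aestronglyMeasurable (c := C)
    (.of_forall fun x => by rw [Real.norm_of_nonneg (hd.nonneg x)]; exact hC x)

/-- `|∇p|² = p · (|∇φ|² p) ≤ C |∇φ|² p`, so boundedness turns finite Fisher information into an `L²`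
gradient. -/
theorem IsRegularDensity.memLp_two_fderiv (hp : IsRegularDensity p) {C : ℝ}
    (hC : ∀ x, p x ≤ C) : MemLp (fderiv ℝ p) 2 volume := by
  have hc : Continuous (fderiv ℝ p) := hp.contDiff_self.continuous_fderiv (by norm_num)
  refine (memLp_two_iff_integrable_sq_norm hc.aestronglyMeasurable).2 ?_
  refine (hp.fisher.const_mul C).mono' (hc.norm.pow 2).aestronglyMeasurable (.of_forall fun x => ?_)
  rw [Real.norm_of_nonneg (by positivity), hp.norm_fderiv, mul_pow, sq (p x), mul_assoc,
    mul_comm (p x) (_ ^ 2)]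
  exact mul_le_mul_of_nonneg_right (hC x) (mul_nonneg (sq_nonneg _) (hp.pos x).le)

/-- From `|∇p| = |∇φ| p ≤ (1 + |∇φ|²) p`. -/
theorem IsRegularDensity.integrable_fderiv (hp : IsRegularDensity p) (hd : IsDensity p) :
    Integrable (fderiv ℝ p) volume := by
  have hc : Continuous (fderiv ℝ p) := hp.contDiff_self.continuous_fderiv (by norm_num)
  refine (hd.integrable.add hp.fisher).mono' hc.aestronglyMeasurable (.of_forall fun x => ?_)
  rw [hp.norm_fderiv, Pi.add_apply]
  have := hp.pos x
  nlinarith [sq_nonneg (‖gradient (potential p) x‖ - 1), norm_nonneg (gradient (potential p) x),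
    mul_nonneg this.le (sq_nonneg (‖gradient (potential p) x‖ - 1))]

theorem integral_mul_comp_sub_swap (f g : EuclideanSpace ℝ (Fin d) → ℝ)
    (z : EuclideanSpace ℝ (Fin d)) : ∫ x, f x * g (z - x) = ∫ x, g x * f (z - x) := by
  rw [← integral_sub_left_eq_self _ volume z]
  simp only [sub_sub_cancel, mul_comm]

theorem conv_comm (p q : EuclideanSpace ℝ (Fin d) → ℝ) : conv p q = conv q p :=
  funext fun z => integral_mul_comp_sub_swap p q z

theorem hasFDerivAt_conv (hp2 : MemLp p 2 volume) (hq : ContDiff ℝ 1 q) (hq2 : MemLp q 2 volume)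
    (hDq : MemLp (fderiv ℝ q) 2 volume) (z : EuclideanSpace ℝ (Fin d)) :
    HasFDerivAt (conv p q) (∫ x, p x • fderiv ℝ q (z - x)) z :=
  hasFDerivAt_integral_smul_comp_sub hp2 hq hq2 hDq z

theorem fderiv_conv_apply (hp2 : MemLp p 2 volume) (hq : ContDiff ℝ 1 q) (hq2 : MemLp q 2 volume)
    (hDq : MemLp (fderiv ℝ q) 2 volume) (z a : EuclideanSpace ℝ (Fin d)) :
    fderiv ℝ (conv p q) z a = ∫ x, fderiv ℝ q x a * p (z - x) := by
  rw [(hasFDerivAt_conv hp2 hq hq2 hDq z).fderiv,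
    ContinuousLinearMap.integral_apply (integrable_smul_comp_sub hp2 hDq _),
    ← integral_mul_comp_sub_swap p (fun x => fderiv ℝ q x a)]
  rfl

/-- The first derivative falls on `q`; after `x ↦ z - x` the second one falls on `p`. Thus only
first derivatives of each factor need be in `L²`. -/
theorem hasFDerivAt_fderiv_conv_apply (hp : ContDiff ℝ 1 p) (hp2 : MemLp p 2 volume)
    (hDp : MemLp (fderiv ℝ p) 2 volume) (hq : ContDiff ℝ 1 q) (hq2 : MemLp q 2 volume)
    (hDq : MemLp (fderiv ℝ q) 2 volume) (z a : EuclideanSpace ℝ (Fin d)) :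
    HasFDerivAt (fun z => fderiv ℝ (conv p q) z a)
      (∫ x, fderiv ℝ q x a • fderiv ℝ p (z - x)) z := by
  rw [show (fun z => fderiv ℝ (conv p q) z a) = fun z => ∫ x, fderiv ℝ q x a • p (z - x) from
    funext fun z => fderiv_conv_apply hp2 hq hq2 hDq z a]
  exact hasFDerivAt_integral_smul_comp_sub
    (memLp_clm_apply hDq a) hp hp2 hDp z

theorem contDiff_two_conv (hp : ContDiff ℝ 1 p) (hp2 : MemLp p 2 volume)
    (hDp : MemLp (fderiv ℝ p) 2 volume) (hq : ContDiff ℝ 1 q) (hq2 : MemLp q 2 volume)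
    (hDq : MemLp (fderiv ℝ q) 2 volume) : ContDiff ℝ 2 (conv p q) := by
  rw [show (2 : WithTop ℕ∞) = 1 + 1 by norm_num, contDiff_succ_iff_fderiv]
  refine ⟨fun z => (hasFDerivAt_conv hp2 hq hq2 hDq z).differentiableAt, by simp, ?_⟩
  refine contDiff_clm_apply_iff.2 fun a => contDiff_one_iff_fderiv.2 ⟨fun z =>
    (hasFDerivAt_fderiv_conv_apply hp hp2 hDp hq hq2 hDq z a).differentiableAt, ?_⟩
  rw [show fderiv ℝ (fun z => fderiv ℝ (conv p q) z a)
      = fun z => ∫ x, fderiv ℝ q x a • fderiv ℝ p (z - x) from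
    funext fun z => (hasFDerivAt_fderiv_conv_apply hp hp2 hDp hq hq2 hDq z a).fderiv]
  exact continuous_integral_smul_comp_sub (memLp_clm_apply hDq a) hDp

end RegularDensity

/-! ### Joint convexity of the perturbed potential and symmetric second differences. -/

section SecondOrder

variable {E : Type*} [NormedAddCommGroup E] [NormedSpace ℝ E]

theorem hasDerivAt_comp_line {f : E → ℝ} (hf : ContDiff ℝ 2 f) (w u : E) (s : ℝ) :
    HasDerivAt (fun s : ℝ => f (w + s • u)) (fderiv ℝ f (w + s • u) u) s := by
  have h1 : HasDerivAt (fun s : ℝ => w + s • u) u s := by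
    simpa using ((hasDerivAt_id s).smul_const u).const_add w
  exact (hf.differentiable (by norm_num) _).hasFDerivAt.comp_hasDerivAt s h1

theorem hasDerivAt_fderiv_comp_line {f : E → ℝ} (hf : ContDiff ℝ 2 f) (w u : E) (s : ℝ) :
    HasDerivAt (fun s : ℝ => fderiv ℝ f (w + s • u) u)
      (fderiv ℝ (fderiv ℝ f) (w + s • u) u u) s := by
  have h1 : HasDerivAt (fun s : ℝ => w + s • u) u s := by
    simpa using ((hasDerivAt_id s).smul_const u).const_add w
  have hd : Differentiable ℝ (fderiv ℝ f) :=
    (hf.fderiv_right (m := 1) (by norm_num)).differentiable (by norm_num)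
  have h2 := (hd (w + s • u)).hasFDerivAt.comp_hasDerivAt s h1
  simpa using h2.clm_apply (hasDerivAt_const s u)

theorem two_mul_le_of_second_deriv_nonneg {f f' f'' : ℝ → ℝ} (hf : ∀ s, HasDerivAt f (f' s) s)
    (hf' : ∀ s, HasDerivAt f' (f'' s) s) (h : ∀ s, |s| ≤ 1 → 0 ≤ f'' s) :
    2 * f 0 ≤ f 1 + f (-1) := by
  have hc : ConvexOn ℝ (Set.Icc (-1 : ℝ) 1) f := by
    refine convexOn_of_hasDerivWithinAt2_nonneg (convex_Icc _ _)
      (fun s _ => (hf s).continuousAt.continuousWithinAt) (fun s _ => (hf s).hasDerivWithinAt)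
      (fun s _ => (hf' s).hasDerivWithinAt) fun s hs => h s ?_
    have hs' : s ∈ Set.Icc (-1 : ℝ) 1 := interior_subset hs
    exact abs_le.2 hs'
  have := hc.2 (show (1 : ℝ) ∈ Set.Icc (-1 : ℝ) 1 by simp)
    (show (-1 : ℝ) ∈ Set.Icc (-1 : ℝ) 1 by simp) (show (0 : ℝ) ≤ 1 / 2 by norm_num)
    (show (0 : ℝ) ≤ 1 / 2 by norm_num) (by norm_num)
  norm_num at this
  linarith

/-- The second derivative at `(x, t)` in the direction `(u, h)` of
`(x, t) ↦ φ x + ψ (z + t a - x) - η x * t ^ 2 / 2`. -/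
noncomputable def perturbedForm (φ ψ η : E → ℝ) (z a : E) (t : ℝ) (x u : E) (h : ℝ) : ℝ :=
  fderiv ℝ (fderiv ℝ φ) x u u
    + fderiv ℝ (fderiv ℝ ψ) (z + t • a - x) (h • a - u) (h • a - u)
    - (fderiv ℝ (fderiv ℝ η) x u u * t ^ 2 / 2 + 2 * (fderiv ℝ η x u * t * h) + η x * h ^ 2)

theorem perturbedForm_smul (φ ψ η : E → ℝ) (z a : E) (t : ℝ) (x u : E) (h r : ℝ) :
    perturbedForm φ ψ η z a t x (r • u) (r * h) = r ^ 2 * perturbedForm φ ψ η z a t x u h := by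
  have : (r * h) • a - r • u = r • (h • a - u) := by module
  simp only [perturbedForm, this, map_smul, smul_apply, smul_eq_mul]
  ring

theorem ContDiff.continuous_fderiv_fderiv {f : E → ℝ} (hf : ContDiff ℝ 2 f) :
    Continuous (fderiv ℝ (fderiv ℝ f)) :=
  (hf.fderiv_right (m := 1) (by norm_num)).continuous_fderiv (by norm_num)

/-- At `t = 0` the form is positive on the compact set `tsupport η` times the unit sphere, hence
still positive there for small `t`, and homogeneity covers all `(u, h)`. Off `tsupport η` only the
two convex terms remain. -/
theorem exists_perturbedForm_nonneg [FiniteDimensional ℝ E] {φ ψ η : E → ℝ} (hφ : ContDiff ℝ 2 φ)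
    (hψ : ContDiff ℝ 2 ψ) (hη : ContDiff ℝ 2 η) (hηc : HasCompactSupport η)
    (hφp : ∀ x u, u ≠ 0 → 0 < fderiv ℝ (fderiv ℝ φ) x u u)
    (hψp : ∀ x u, u ≠ 0 → 0 < fderiv ℝ (fderiv ℝ ψ) x u u) (z a : E)
    (hlt : ∀ x u, ∀ h : ℝ, h ≠ 0 → η x * h ^ 2 < fderiv ℝ (fderiv ℝ φ) x u u
      + fderiv ℝ (fderiv ℝ ψ) (z - x) (h • a - u) (h • a - u)) :
    ∃ δ > 0, ∀ t : ℝ, |t| ≤ δ → ∀ x u h, 0 ≤ perturbedForm φ ψ η z a t x u h := by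
  have hφ2 := hφ.continuous_fderiv_fderiv
  have hψ2 := hψ.continuous_fderiv_fderiv
  have hη2 := hη.continuous_fderiv_fderiv
  have hη1 : Continuous (fderiv ℝ η) := hη.continuous_fderiv (by norm_num)
  have hη0 := hη.continuous
  have hcont : Continuous fun w : ℝ × (E × (E × ℝ)) =>
      perturbedForm φ ψ η z a w.1 w.2.1 w.2.2.1 w.2.2.2 := by
    unfold perturbedForm
    refine ((((hφ2.comp (by fun_prop)).clm_apply (by fun_prop)).clm_apply (by fun_prop)).add
      (((hψ2.comp (by fun_prop)).clm_apply (by fun_prop)).clm_apply (by fun_prop))).sub ?_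
    refine Continuous.add (Continuous.add ?_ ?_) ?_
    · have : Continuous fun w : ℝ × (E × (E × ℝ)) =>
          fderiv ℝ (fderiv ℝ η) w.2.1 w.2.2.1 w.2.2.1 :=
        ((hη2.comp (by fun_prop)).clm_apply (by fun_prop)).clm_apply (by fun_prop)
      fun_prop
    · have : Continuous fun w : ℝ × (E × (E × ℝ)) => fderiv ℝ η w.2.1 w.2.2.1 :=
        (hη1.comp (by fun_prop)).clm_apply (by fun_prop)
      fun_prop
    · fun_prop
  have hcomp : IsCompact (tsupport η ×ˢ Metric.sphere (0 : E × ℝ) 1) :=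
    hηc.isCompact.prod (isCompact_sphere _ _)
  have hev := hcomp.eventually_forall_of_forall_eventually (x₀ := (0 : ℝ))
    (P := fun t w => 0 < perturbedForm φ ψ η z a t w.1 w.2.1 w.2.2) (by
      rintro ⟨x, u, h⟩ ⟨-, hs⟩
      refine hcont.continuousAt.eventually_const_lt ?_
      simp only [perturbedForm, zero_smul, add_zero]
      -- For `h = 0` the hypothesis `hlt` is silent, and strict convexity of `φ` and `ψ` takes over.
      rcases eq_or_ne h 0 with rfl | hh
      · have hu : u ≠ 0 := by
          rintro rfl
          simp [Prod.norm_def] at hs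
        have h1 := hφp x u hu
        have h2 := hψp (z - x) (-u) (neg_ne_zero.2 hu)
        simp only [zero_smul, zero_sub]
        linarith
      · have := hlt x u h hh
        linarith)
  obtain ⟨δ, hδ, hball⟩ := Metric.eventually_nhds_iff.1 hev
  refine ⟨δ / 2, half_pos hδ, fun t ht x u h => ?_⟩
  by_cases hx : x ∈ tsupport η
  · rcases eq_or_ne ((u, h) : E × ℝ) 0 with h0 | h0
    · obtain ⟨rfl, rfl⟩ : u = 0 ∧ h = 0 := Prod.mk_eq_zero.1 h0
      simp [perturbedForm]
    · set r := ‖((u, h) : E × ℝ)‖ with hr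
      have hr0 : 0 < r := norm_pos_iff.2 h0
      have hmem : ((x, (r⁻¹ • u, r⁻¹ * h)) : E × (E × ℝ))
          ∈ tsupport η ×ˢ Metric.sphere (0 : E × ℝ) 1 := by
        refine ⟨hx, ?_⟩
        have : ((r⁻¹ • u, r⁻¹ * h) : E × ℝ) = r⁻¹ • ((u, h) : E × ℝ) := rfl
        simp only [mem_sphere_zero_iff_norm]
        rw [this, norm_smul, norm_inv, Real.norm_of_nonneg hr0.le, ← hr, inv_mul_cancel₀ hr0.ne']
      have hpos := hball (y := t) (by rw [Real.dist_0_eq_abs]; linarith) _ hmem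
      simp only [perturbedForm_smul] at hpos
      exact (pos_of_mul_pos_right hpos (by positivity)).le
  · have e0 : η x = 0 := image_eq_zero_of_notMem_tsupport hx
    have e1 : fderiv ℝ η x = 0 := fderiv_of_notMem_tsupport ℝ hx
    have e2 : fderiv ℝ (fderiv ℝ η) x = 0 :=
      fderiv_of_notMem_tsupport ℝ fun h' => hx (tsupport_fderiv_subset ℝ h')
    have hnn : ∀ {f : E → ℝ} (_ : ∀ x u, u ≠ 0 → 0 < fderiv ℝ (fderiv ℝ f) x u u) (x u),
        0 ≤ fderiv ℝ (fderiv ℝ f) x u u := by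
      intro f hf x u
      rcases eq_or_ne u 0 with rfl | hu
      · simp
      · exact (hf x u hu).le
    simp only [perturbedForm, e0, e1, e2]
    simpa using add_nonneg (hnn hφp x u) (hnn hψp (z + t • a - x) (h • a - u))

/-- Convexity of the perturbed potential along the segment from `(y, -h)` to `(x, h)`. Its midpoint
has `t = 0`, so `η` drops out there. -/
theorem midpoint_le_of_perturbedForm_nonneg {φ ψ η : E → ℝ} (hφ : ContDiff ℝ 2 φ)
    (hψ : ContDiff ℝ 2 ψ) (hη : ContDiff ℝ 2 η) {z a : E} {δ : ℝ}
    (hnn : ∀ t : ℝ, |t| ≤ δ → ∀ x u h, 0 ≤ perturbedForm φ ψ η z a t x u h) {h : ℝ}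
    (hh : |h| ≤ δ) (x y : E) :
    2 * (φ ((1 / 2 : ℝ) • x + (1 / 2 : ℝ) • y) + ψ (z - ((1 / 2 : ℝ) • x + (1 / 2 : ℝ) • y)))
      ≤ (φ x + ψ (z + h • a - x) - η x * h ^ 2 / 2)
        + (φ y + ψ (z - h • a - y) - η y * h ^ 2 / 2) := by
  set w := (1 / 2 : ℝ) • x + (1 / 2 : ℝ) • y with hw
  set u := (1 / 2 : ℝ) • x - (1 / 2 : ℝ) • y with hu
  have key := two_mul_le_of_second_deriv_nonneg
    (f := fun s => φ (w + s • u) + ψ ((z - w) + s • (h • a - u))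
      - η (w + s • u) * (s * h) ^ 2 / 2)
    (f' := fun s => fderiv ℝ φ (w + s • u) u + fderiv ℝ ψ ((z - w) + s • (h • a - u)) (h • a - u)
      - (fderiv ℝ η (w + s • u) u * (s * h) ^ 2 / 2 + η (w + s • u) * (s * h) * h))
    (f'' := fun s => perturbedForm φ ψ η z a (s * h) (w + s • u) u h) ?_ ?_ ?_
  · have e1 : w + (1 : ℝ) • u = x := by rw [hw, hu]; module
    have e2 : w + (-1 : ℝ) • u = y := by rw [hw, hu]; module
    have e3 : z - w + (1 : ℝ) • (h • a - u) = z + h • a - x := by rw [hw, hu]; module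
    have e4 : z - w + (-1 : ℝ) • (h • a - u) = z - h • a - y := by rw [hw, hu]; module
    rw [e1, e2, e3, e4] at key
    simpa using key
  · intro s
    have h1 := (hasDerivAt_comp_line hφ w u s).add (hasDerivAt_comp_line hψ (z - w) (h • a - u) s)
    have h2 : HasDerivAt (fun s : ℝ => (s * h) ^ 2) (2 * (s * h) * h) s := by
      have := ((hasDerivAt_id s).mul_const h).pow 2
      exact this.congr_deriv (by simp)
    have h3 := ((hasDerivAt_comp_line hη w u s).mul h2).div_const 2
    exact (h1.sub h3).congr_deriv (by ring)
  · intro s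
    have h1 := (hasDerivAt_fderiv_comp_line hφ w u s).add
      (hasDerivAt_fderiv_comp_line hψ (z - w) (h • a - u) s)
    have h2 : HasDerivAt (fun s : ℝ => (s * h) ^ 2) (2 * (s * h) * h) s := by
      have := ((hasDerivAt_id s).mul_const h).pow 2
      exact this.congr_deriv (by simp)
    have h2' : HasDerivAt (fun s : ℝ => s * h) h s := by
      simpa using (hasDerivAt_id s).mul_const h
    have h3 := ((hasDerivAt_fderiv_comp_line hη w u s).mul h2).div_const 2
    have h4 := ((hasDerivAt_comp_line hη w u s).mul h2').mul_const h
    have e : z + (s * h) • a - (w + s • u) = z - w + s • (h • a - u) := by module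
    exact (h1.sub (h3.add h4)).congr_deriv (by simp only [perturbedForm, e]; ring)
  · intro s hs
    refine hnn _ ?_ _ _ _
    rw [abs_mul]
    exact (mul_le_of_le_one_left (abs_nonneg h) hs).trans hh

/-- If the symmetric second difference of `f` at `0` is at least `(r h + r (-h)) h² / 2` for small
`h`, then `f'' 0 ≥ r 0`. -/
theorem le_second_deriv_of_symm_diff {f f' r : ℝ → ℝ} {c δ : ℝ} (hδ : 0 < δ)
    (hf : ∀ s, HasDerivAt f (f' s) s) (hf' : HasDerivAt f' c 0) (hr : ContinuousAt r 0)
    (h : ∀ s, |s| ≤ δ → (r s + r (-s)) * s ^ 2 / 2 ≤ f s + f (-s) - 2 * f 0) : r 0 ≤ c := by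
  by_contra! hlt
  -- With `c < k < r 0`, the function `g s = f s + f (-s) - k s²` has second derivative `2 (c - k) <
  -- 0` at `0`, so a local maximum there. The hypothesis makes `0` a local minimum as well, so `g`
  -- is locally constant, a contradiction.
  obtain ⟨k, hck, hkr⟩ := exists_between hlt
  set g : ℝ → ℝ := fun s => f s + f (-s) - k * s ^ 2 with hg
  have hgd : ∀ s, HasDerivAt g (f' s - f' (-s) - 2 * k * s) s := by
    intro s
    have h1 : HasDerivAt (fun s => f (-s)) (-f' (-s)) s := by
      exact ((hf (-s)).comp s (hasDerivAt_neg s)).congr_deriv (by ring)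
    have h2 : HasDerivAt (fun s : ℝ => k * s ^ 2) (k * (2 * s)) s := by
      simpa using (hasDerivAt_pow 2 s).const_mul k
    exact (((hf s).add h1).sub h2).congr_deriv (by ring)
  have hgdd : HasDerivAt (deriv g) (2 * c - 2 * k) 0 := by
    rw [show deriv g = fun s => f' s - f' (-s) - 2 * k * s from funext fun s => (hgd s).deriv]
    have h1 : HasDerivAt (fun s => f' (-s)) (-c) 0 := by
      have h0 : HasDerivAt f' c (-0) := by simpa using hf'
      exact (h0.comp (0 : ℝ) (hasDerivAt_neg (0 : ℝ))).congr_deriv (by ring)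
    have h2 : HasDerivAt (fun s : ℝ => 2 * k * s) (2 * k) 0 := by
      simpa using (hasDerivAt_id (0 : ℝ)).const_mul (2 * k)
    exact ((hf'.sub h1).sub h2).congr_deriv (by ring)
  have hmax : IsLocalMax g 0 := by
    refine isLocalMax_of_deriv_deriv_neg ?_ ?_ (hgd 0).continuousAt
    · rw [hgdd.deriv]; linarith
    · rw [(hgd 0).deriv]; simp
  have hrn : ContinuousAt (fun s => r (-s)) 0 :=
    ContinuousAt.comp (by simpa using hr) continuousAt_neg
  have hge : ∀ᶠ s in nhds (0 : ℝ), g 0 ≤ g s := by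
    filter_upwards [hr.eventually_const_lt hkr, hrn.eventually_const_lt (by simpa using hkr),
      Metric.ball_mem_nhds (0 : ℝ) hδ] with s h1 h2 h3
    rw [mem_ball_zero_iff, Real.norm_eq_abs] at h3
    have := h s h3.le
    simp only [hg]
    norm_num
    nlinarith [sq_nonneg s]
  have hconst : g =ᶠ[nhds 0] fun _ => g 0 := by
    filter_upwards [hmax, hge] with s h1 h2
    exact le_antisymm h1 h2
  have hd0 : deriv g =ᶠ[nhds 0] fun _ => 0 := by
    have := hconst.deriv
    simpa using this
  have := hd0.deriv_eq
  rw [hgdd.deriv] at this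
  simp at this
  linarith

end SecondOrder

/-! ### Second variation of the convolution for compactly supported minorants. -/

section SecondVariation

variable {d : ℕ}

/-- The midpoint case of the Prékopa–Leindler inequality for real valued functions. -/
theorem integral_mul_integral_le_sq {f g k : EuclideanSpace ℝ (Fin d) → ℝ} (hfm : Measurable f)
    (hgm : Measurable g) (hkm : Measurable k) (hf : Integrable f volume)
    (hg : Integrable g volume) (hk : Integrable k volume) (hf0 : ∀ x, 0 ≤ f x)
    (hg0 : ∀ x, 0 ≤ g x) (hk0 : ∀ x, 0 ≤ k x)
    (h : ∀ x y, f x * g y ≤ k ((1 / 2 : ℝ) • x + (1 / 2 : ℝ) • y) ^ 2) :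
    (∫ x, f x) * (∫ x, g x) ≤ (∫ x, k x) ^ 2 := by
  have e : (1 : ℝ) - 1 / 2 = 1 / 2 := by norm_num
  have hsq : ∀ {a b c : ℝ}, 0 ≤ a → 0 ≤ b → 0 ≤ c →
      ((ENNReal.ofReal a) ^ (1 / 2 : ℝ) * (ENNReal.ofReal b) ^ (1 / 2 : ℝ) ≤ ENNReal.ofReal c
        ↔ a * b ≤ c ^ 2) := by
    intro a b c ha hb hc
    rw [ENNReal.ofReal_rpow_of_nonneg ha (by norm_num),
      ENNReal.ofReal_rpow_of_nonneg hb (by norm_num), ← ENNReal.ofReal_mul (by positivity),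
      ENNReal.ofReal_le_ofReal_iff hc, ← Real.mul_rpow ha hb, ← Real.sqrt_eq_rpow,
      Real.sqrt_le_left hc]
  have key := prekopaLeindler (θ := 1 / 2) (by norm_num) (by norm_num) hfm.ennreal_ofReal
    hgm.ennreal_ofReal hkm.ennreal_ofReal (by
      intro x y
      rw [e]
      exact (hsq (hf0 x) (hg0 y) (hk0 _)).2 (h x y))
  rw [e, ← ofReal_integral_eq_lintegral_ofReal hf (.of_forall hf0),
    ← ofReal_integral_eq_lintegral_ofReal hg (.of_forall hg0),
    ← ofReal_integral_eq_lintegral_ofReal hk (.of_forall hk0)] at key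
  exact (hsq (integral_nonneg hf0) (integral_nonneg hg0) (integral_nonneg hk0)).1 key

/-- Jensen's inequality for the exponential function and an unnormalised density. -/
theorem integral_mul_exp_le_integral_exp_mul {α : Type*} [MeasurableSpace α] {μ : Measure α}
    {ρ η : α → ℝ} (hρ : ∀ x, 0 ≤ ρ x) (hρi : Integrable ρ μ) (hpos : 0 < ∫ x, ρ x ∂μ)
    (hη : Integrable (fun x => η x * ρ x) μ)
    (hexp : Integrable (fun x => ρ x * Real.exp (η x)) μ) :
    (∫ x, ρ x ∂μ) * Real.exp ((∫ x, η x * ρ x ∂μ) / ∫ x, ρ x ∂μ)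
      ≤ ∫ x, ρ x * Real.exp (η x) ∂μ := by
  set Z := ∫ x, ρ x ∂μ with hZ
  set c := (∫ x, η x * ρ x ∂μ) / Z with hc
  -- The tangent line of `exp` at the weighted mean `c` of `η`.
  have h1 : ∀ x, Real.exp c * ((1 - c) * ρ x + η x * ρ x) ≤ ρ x * Real.exp (η x) := by
    intro x
    have h2 : Real.exp c * (η x - c + 1) ≤ Real.exp (η x) := by
      calc Real.exp c * (η x - c + 1) ≤ Real.exp c * Real.exp (η x - c) := by
            gcongr; exact Real.add_one_le_exp _
        _ = Real.exp (η x) := by rw [← Real.exp_add]; congr 1; ring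
    calc _ = ρ x * (Real.exp c * (η x - c + 1)) := by ring
      _ ≤ _ := mul_le_mul_of_nonneg_left h2 (hρ x)
  have h3 := integral_mono (((hρi.const_mul (1 - c)).add hη).const_mul (Real.exp c)) hexp h1
  refine le_trans (le_of_eq ?_) h3
  rw [integral_const_mul]
  simp only [Pi.add_apply]
  rw [integral_add (hρi.const_mul _) hη, integral_const_mul, ← hZ]
  have : ∫ x, η x * ρ x ∂μ = c * Z := by rw [hc, div_mul_cancel₀ _ hpos.ne']
  rw [this]
  ring

theorem conv_pos {p q : EuclideanSpace ℝ (Fin d) → ℝ} (hp : ∀ x, 0 < p x) (hq : ∀ x, 0 < q x)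
    (z : EuclideanSpace ℝ (Fin d)) (hint : Integrable (fun x => p x * q (z - x)) volume) :
    0 < conv p q z := by
  rw [conv_apply, integral_pos_iff_support_of_nonneg
    (fun x => (mul_pos (hp x) (hq _)).le) hint]
  have : (Function.support fun x => p x * q (z - x)) = Set.univ := by
    ext x
    simpa using ⟨(hp x).ne', (hq (z - x)).ne'⟩
  rw [this]
  exact isOpen_univ.measure_pos volume Set.univ_nonempty

theorem contDiff_potential {f : EuclideanSpace ℝ (Fin d) → ℝ} (hf : ContDiff ℝ 2 f)
    (hpos : ∀ x, 0 < f x) : ContDiff ℝ 2 (potential f) :=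
  (hf.log fun x => (hpos x).ne').neg

/-- The second derivative of `-log (p ⋆ q)` dominates the conditional mean of a compactly supported
function lying below the Schur complement of the joint second derivative. -/
theorem integral_div_conv_le_second_deriv {p q η : EuclideanSpace ℝ (Fin d) → ℝ}
    (hp : IsRegularDensity p) (hq : IsRegularDensity q) (hpd : IsDensity p) (hqd : IsDensity q)
    {C : ℝ} (hpC : ∀ x, p x ≤ C) (hqC : ∀ x, q x ≤ C)
    (hZ : ContDiff ℝ 2 (potential (conv p q)))
    (hη : ContDiff ℝ 2 η) (hηc : HasCompactSupport η)
    (hφp : ∀ x u, u ≠ 0 → 0 < fderiv ℝ (fderiv ℝ (potential p)) x u u)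
    (hψp : ∀ x u, u ≠ 0 → 0 < fderiv ℝ (fderiv ℝ (potential q)) x u u)
    (z a : EuclideanSpace ℝ (Fin d))
    (hlt : ∀ x u, ∀ h : ℝ, h ≠ 0 → η x * h ^ 2 < fderiv ℝ (fderiv ℝ (potential p)) x u u
      + fderiv ℝ (fderiv ℝ (potential q)) (z - x) (h • a - u) (h • a - u)) :
    (∫ x, η x * (p x * q (z - x))) / conv p q z
      ≤ fderiv ℝ (fderiv ℝ (potential (conv p q))) z a a := by
  obtain ⟨δ, hδ, hnn⟩ := exists_perturbedForm_nonneg hp.contDiff hq.contDiff hη hηc hφp hψp z a hlt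
  have hp2 := hpd.memLp_two hpC
  have hq2 := hqd.memLp_two hqC
  have hint : ∀ y, Integrable (fun x => p x * q (y - x)) volume := fun y =>
    integrable_smul_comp_sub hp2 hq2 y
  have hpos := fun y => conv_pos hp.pos hq.pos y (hint y)
  obtain ⟨K, hK⟩ := hηc.exists_bound_of_continuous hη.continuous
  have hηm : Measurable η := hη.continuous.measurable
  -- Makes the numerator of `r` a convolution of two `L²` functions, so that `r` is continuous at
  -- `0`.
  have hηp2 : MemLp (fun x => η x * p x) 2 volume :=
    hp2.of_le_mul (c := K) (by have := hpd.measurable; fun_prop) (.of_forall fun x => by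
      rw [norm_mul]; gcongr; exact hK x)
  have hNint : ∀ y, Integrable (fun x => η x * (p x * q (y - x))) volume := fun y => by
    simpa only [smul_eq_mul, mul_assoc] using integrable_smul_comp_sub hηp2 hq2 y
  have hNc : Continuous fun y => ∫ x, η x * (p x * q (y - x)) := by
    simpa only [smul_eq_mul, mul_assoc] using continuous_integral_smul_comp_sub hηp2 hq2
  have hZc : Continuous (conv p q) := continuous_integral_smul_comp_sub hp2 hq2
  set r : ℝ → ℝ := fun s =>
    (∫ x, η x * (p x * q (z + s • a - x))) / conv p q (z + s • a) with hr
  have hrc : Continuous r :=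
    (hNc.comp (by fun_prop)).div₀ (hZc.comp (by fun_prop)) fun s => (hpos _).ne'
  have key := le_second_deriv_of_symm_diff hδ (hasDerivAt_comp_line hZ z a)
    (hasDerivAt_fderiv_comp_line hZ z a 0) hrc.continuousAt ?_
  · simpa [hr] using key
  intro s hs
  have hpm := hpd.measurable
  have hqm := hqd.measurable
  have hexpint : ∀ y (c : ℝ), Integrable
      (fun x => p x * q (y - x) * Real.exp (η x * c)) volume := by
    intro y c
    refine (hint y).mul_bdd (c := Real.exp (K * |c|)) (by fun_prop) (.of_forall fun x => ?_)
    rw [Real.norm_of_nonneg (Real.exp_pos _).le]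
    apply Real.exp_le_exp.2
    calc η x * c ≤ |η x * c| := le_abs_self _
      _ = ‖η x‖ * |c| := by rw [abs_mul, Real.norm_eq_abs]
      _ ≤ K * |c| := by gcongr; exact hK x
  set c := s ^ 2 / 2 with hc
  -- Prékopa–Leindler at the midpoint. The weights `exp(η s²/2)` are what the convexity of the
  -- perturbed potential allows beyond plain log-concavity.
  have hmid : (∫ x, p x * q (z + s • a - x) * Real.exp (η x * c))
      * (∫ x, p x * q (z - s • a - x) * Real.exp (η x * c)) ≤ conv p q z ^ 2 := by
    rw [conv_apply]
    refine integral_mul_integral_le_sq (by fun_prop) (by fun_prop) (by fun_prop)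
      (hexpint _ c) (hexpint _ c) (hint z)
      (fun x => mul_nonneg (mul_nonneg (hp.pos _).le (hq.pos _).le) (Real.exp_pos _).le)
      (fun x => mul_nonneg (mul_nonneg (hp.pos _).le (hq.pos _).le) (Real.exp_pos _).le)
      (fun x => mul_nonneg (hp.pos _).le (hq.pos _).le) ?_
    intro x y
    have := midpoint_le_of_perturbedForm_nonneg hp.contDiff hq.contDiff hη hnn hs x y
    rw [hp.eq_exp x, hp.eq_exp y, hq.eq_exp (z + s • a - x), hq.eq_exp (z - s • a - y),
      hp.eq_exp ((1 / 2 : ℝ) • x + (1 / 2 : ℝ) • y), hq.eq_exp (z - _), sq]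
    simp only [← Real.exp_add]
    apply Real.exp_le_exp.2
    rw [hc]
    linarith
  -- Jensen extracts the conditional mean of `η`; the product of these bounds at `z ± s a`, after
  -- taking logarithms, is the second-difference inequality.
  have hjen : ∀ y, conv p q y * Real.exp ((∫ x, η x * (p x * q (y - x))) / conv p q y * c)
      ≤ ∫ x, p x * q (y - x) * Real.exp (η x * c) := by
    intro y
    have h1 := integral_mul_exp_le_integral_exp_mul (η := fun x => η x * c)
      (fun x => (mul_pos (hp.pos x) (hq.pos (y - x))).le) (hint y) (hpos y)
      (by simpa only [mul_assoc, mul_comm, mul_left_comm] using (hNint y).mul_const c)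
      (hexpint y c)
    have h2 : ∫ x, η x * c * (p x * q (y - x)) = (∫ x, η x * (p x * q (y - x))) * c := by
      rw [← integral_mul_const]
      refine integral_congr_ae (.of_forall fun x => ?_)
      ring
    rw [h2, mul_div_right_comm] at h1
    exact h1
  have hlog : ∀ y, conv p q y = Real.exp (-potential (conv p q) y) := fun y => by
    rw [potential, neg_neg, Real.exp_log (hpos y)]
  have hfin := (mul_le_mul (hjen (z + s • a)) (hjen (z - s • a))
    (mul_nonneg (hpos _).le (Real.exp_pos _).le) ((mul_pos (hpos _) (Real.exp_pos _)).le.trans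
      (hjen _))).trans hmid
  have e1 : z - s • a = z + (-s) • a := by module
  rw [e1] at hfin
  change conv p q (z + s • a) * Real.exp (r s * c)
    * (conv p q (z + (-s) • a) * Real.exp (r (-s) * c)) ≤ _ at hfin
  rw [hlog (z + s • a), hlog (z + (-s) • a), hlog z, sq] at hfin
  simp only [← Real.exp_add] at hfin
  have hfin' := Real.exp_le_exp.1 hfin
  rw [hc] at hfin'
  simp only [zero_smul, add_zero]
  linarith

end SecondVariation

/-! ### Hessian matrices of potentials and their positive definiteness. -/

section HessianMatrix

variable {d : ℕ}

theorem hessian_apply (f : EuclideanSpace ℝ (Fin d) → ℝ) (x : EuclideanSpace ℝ (Fin d))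
    (i j : Fin d) : hessian f x i j = fderiv ℝ (fderiv ℝ f) x (EuclideanSpace.single i 1)
      (EuclideanSpace.single j 1) := by
  simp [hessian, iteratedFDeriv_two_apply]

theorem dotProduct_hessian_mulVec (f : EuclideanSpace ℝ (Fin d) → ℝ)
    (x u v : EuclideanSpace ℝ (Fin d)) :
    u.ofLp ⬝ᵥ (hessian f x).mulVec v.ofLp = fderiv ℝ (fderiv ℝ f) x u v := by
  have hsum : ∀ w : EuclideanSpace ℝ (Fin d), w = ∑ i, w i • EuclideanSpace.single i (1 : ℝ) := by
    intro w
    simpa using ((EuclideanSpace.basisFun (Fin d) ℝ).sum_repr w).symm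
  conv_rhs => rw [hsum u, hsum v]
  simp only [map_sum, map_smul, sum_apply, smul_apply, smul_eq_mul, dotProduct,
    Matrix.mulVec, hessian_apply, Finset.mul_sum]
  rw [Finset.sum_comm]
  refine Finset.sum_congr rfl fun i _ => Finset.sum_congr rfl fun j _ => ?_
  ring

theorem isHermitian_hessian {f : EuclideanSpace ℝ (Fin d) → ℝ} (hf : ContDiff ℝ 2 f)
    (x : EuclideanSpace ℝ (Fin d)) : (hessian f x).IsHermitian := by
  ext i j
  rw [Matrix.conjTranspose_apply, star_trivial, hessian_apply, hessian_apply]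
  exact (hf.contDiffAt.isSymmSndFDerivAt (by simp)) _ _

theorem continuous_hessian {f : EuclideanSpace ℝ (Fin d) → ℝ} (hf : ContDiff ℝ 2 f) :
    Continuous (hessian f) := by
  refine continuous_matrix fun i j => ?_
  simp only [hessian_apply]
  exact (hf.continuous_fderiv_fderiv.clm_apply continuous_const).clm_apply continuous_const

theorem gaussianDensity_mul_symm {v : ℝ} (hv : 0 < v) (x u : EuclideanSpace ℝ (Fin d)) :
    gaussianDensity d v (x + u) * gaussianDensity d v (x - u)
      = gaussianDensity d v x ^ 2 * Real.exp (-(‖u‖ ^ 2 / v)) := by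
  unfold gaussianDensity
  rw [mul_pow, mul_mul_mul_comm, ← sq, mul_assoc (_ ^ 2), ← Real.exp_add, sq (Real.exp _),
    ← Real.exp_add, ← Real.exp_add, norm_add_sq_real, norm_sub_sq_real]
  congr 2
  field_simp
  ring

/-- The second derivative of the potential of a strongly log-concave density. -/
theorem le_second_deriv_potential {v : ℝ} (hv : 0 < v) {p : EuclideanSpace ℝ (Fin d) → ℝ}
    (hp : p ∈ SLC1 v d) (hreg : IsRegularDensity p) (x u : EuclideanSpace ℝ (Fin d)) :
    ‖u‖ ^ 2 / v ≤ fderiv ℝ (fderiv ℝ (potential p)) x u u := by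
  obtain ⟨-, g, hg, hpg⟩ := hp
  have hgpos : ∀ y, 0 < g y := fun y => by
    have := hreg.pos y
    rw [hpg] at this
    exact pos_of_mul_pos_left this (gaussianDensity_pos d hv y).le
  have key := le_second_deriv_of_symm_diff (r := fun _ => ‖u‖ ^ 2 / v) one_pos
    (hasDerivAt_comp_line hreg.contDiff x u) (hasDerivAt_fderiv_comp_line hreg.contDiff x u 0)
    continuousAt_const ?_
  · simpa using key
  intro s _
  -- Midpoint log-concavity of `g`; the Gaussian factor contributes exactly `exp(-‖s u‖² / v)` by
  -- the parallelogram law.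
  have hmid : p (x + s • u) * p (x + (-s) • u)
      ≤ p x ^ 2 * Real.exp (-(‖u‖ ^ 2 / v * s ^ 2)) := by
    have h1 := hg.rpow_mul_rpow_le (x + s • u) (x + (-s) • u) (θ := 1 / 2) (by norm_num)
      (by norm_num)
    have e1 : (1 / 2 : ℝ) • (x + s • u) + (1 - 1 / 2 : ℝ) • (x + (-s) • u) = x := by module
    rw [e1, show (1 - 1 / 2 : ℝ) = 1 / 2 by norm_num,
      ← Real.mul_rpow (hgpos _).le (hgpos _).le, ← Real.sqrt_eq_rpow,
      Real.sqrt_le_left (hgpos x).le] at h1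
    have h2 := gaussianDensity_mul_symm hv x (s • u)
    rw [norm_smul, mul_pow, Real.norm_eq_abs, sq_abs] at h2
    rw [hpg, hpg, hpg, mul_mul_mul_comm, show x + (-s) • u = x - s • u by module, h2, mul_pow,
      show s ^ 2 * ‖u‖ ^ 2 / v = ‖u‖ ^ 2 / v * s ^ 2 by ring]
    rw [show x + (-s) • u = x - s • u by module] at h1
    refine (mul_le_mul_of_nonneg_right h1 (by positivity)).trans_eq (mul_assoc _ _ _).symm
  rw [hreg.eq_exp x, hreg.eq_exp (x + s • u), hreg.eq_exp (x + (-s) • u), sq (Real.exp _)] at hmid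
  simp only [← Real.exp_add] at hmid
  have := Real.exp_le_exp.1 hmid
  simp only [zero_smul, add_zero]
  linarith

theorem second_deriv_potential_pos {v : ℝ} (hv : 0 < v) {p : EuclideanSpace ℝ (Fin d) → ℝ}
    (hp : p ∈ SLC1 v d) (hreg : IsRegularDensity p) (x u : EuclideanSpace ℝ (Fin d))
    (hu : u ≠ 0) : 0 < fderiv ℝ (fderiv ℝ (potential p)) x u u :=
  lt_of_lt_of_le (by have := norm_pos_iff.2 hu; positivity)
    (le_second_deriv_potential hv hp hreg x u)

theorem posDef_hessian {f : EuclideanSpace ℝ (Fin d) → ℝ} (hf : ContDiff ℝ 2 f)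
    (hpos : ∀ x u, u ≠ 0 → 0 < fderiv ℝ (fderiv ℝ f) x u u) (x : EuclideanSpace ℝ (Fin d)) :
    (hessian f x).PosDef := by
  refine Matrix.PosDef.of_dotProduct_mulVec_pos (isHermitian_hessian hf x) fun u hu => ?_
  rw [star_trivial]
  have := hpos x (WithLp.toLp 2 u) (by simpa using hu)
  rwa [← dotProduct_hessian_mulVec] at this

end HessianMatrix

/-! ### Parallel sums of positive definite matrices. -/

section ParallelSum

variable {n : Type*} [Fintype n] [DecidableEq n]

/-- Fenchel–Young: the form of `A` is nonnegative at `u - A⁻¹ v`. -/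
theorem Matrix.PosDef.two_mul_dotProduct_le {A : Matrix n n ℝ} (hA : A.PosDef) (u v : n → ℝ) :
    2 * (u ⬝ᵥ v) ≤ u ⬝ᵥ A.mulVec u + v ⬝ᵥ A⁻¹.mulVec v := by
  have h := hA.posSemidef.dotProduct_mulVec_nonneg (u - A⁻¹.mulVec v)
  have hu : IsUnit A.det := hA.isUnit.map Matrix.detMonoidHom
  have hs : ∀ x y : n → ℝ, x ⬝ᵥ A.mulVec y = y ⬝ᵥ A.mulVec x := by
    intro x y
    have ht : A.transpose = A := by
      have := hA.isHermitian.eq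
      rwa [Matrix.conjTranspose_eq_transpose_of_trivial] at this
    rw [Matrix.dotProduct_mulVec, ← Matrix.mulVec_transpose, ht, dotProduct_comm]
  have e : A.mulVec (A⁻¹.mulVec v) = v := by
    rw [Matrix.mulVec_mulVec, Matrix.mul_nonsing_inv _ hu, Matrix.one_mulVec]
  rw [star_trivial, Matrix.mulVec_sub, e, sub_dotProduct, dotProduct_sub, dotProduct_sub,
    hs (A⁻¹.mulVec v) u, e, dotProduct_comm (A⁻¹.mulVec v) v] at h
  linarith

/-- The parallel sum of two positive definite matrices is dominated by the infimal convolution of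
their quadratic forms. -/
theorem Matrix.PosDef.parallelSum_le {A B : Matrix n n ℝ} (hA : A.PosDef) (hB : B.PosDef)
    (a u : n → ℝ) : a ⬝ᵥ (A⁻¹ + B⁻¹)⁻¹.mulVec a
      ≤ u ⬝ᵥ A.mulVec u + (a - u) ⬝ᵥ B.mulVec (a - u) := by
  have hS : (A⁻¹ + B⁻¹).PosDef := hA.inv.add hB.inv
  have hu : IsUnit (A⁻¹ + B⁻¹).det := hS.isUnit.map Matrix.detMonoidHom
  -- `v` is the Lagrange multiplier of the infimal convolution, the optimal splitting being `a = A⁻¹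
  -- v + B⁻¹ v`. Fenchel–Young for `(u, v)` and `(a - u, v)` add up to the claim.
  set v := (A⁻¹ + B⁻¹)⁻¹.mulVec a with hv
  have e : A⁻¹.mulVec v + B⁻¹.mulVec v = a := by
    rw [← Matrix.add_mulVec, hv, Matrix.mulVec_mulVec, Matrix.mul_nonsing_inv _ hu,
      Matrix.one_mulVec]
  have h1 := hA.two_mul_dotProduct_le u v
  have h2 := hB.two_mul_dotProduct_le (a - u) v
  have h3 : v ⬝ᵥ A⁻¹.mulVec v + v ⬝ᵥ B⁻¹.mulVec v = a ⬝ᵥ v := by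
    rw [← dotProduct_add, e, dotProduct_comm]
  rw [sub_dotProduct] at h2
  linarith

theorem Continuous.matrix_inv_of_isUnit {α : Type*} [TopologicalSpace α] {A : α → Matrix n n ℝ}
    (hA : Continuous A) (hu : ∀ x, IsUnit (A x).det) : Continuous fun x => (A x)⁻¹ := by
  simp only [Matrix.inv_def, Ring.inverse_eq_inv']
  exact (hA.matrix_det.inv₀ fun x => (hu x).ne_zero).smul hA.matrix_adjugate

end ParallelSum

/-! ### Smooth compactly supported minorants. -/

section Approximation

variable {d : ℕ}

/-- A positive continuous function is a pointwise limit of smooth compactly supported functions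
lying between zero and it. -/
theorem exists_seq_contDiff_lt {m : EuclideanSpace ℝ (Fin d) → ℝ} (hm : Continuous m)
    (hpos : ∀ x, 0 < m x) : ∃ η : ℕ → EuclideanSpace ℝ (Fin d) → ℝ,
      (∀ k, ContDiff ℝ 2 (η k) ∧ HasCompactSupport (η k) ∧ ∀ x, 0 ≤ η k x ∧ η k x < m x) ∧
      ∀ x, Filter.Tendsto (fun k => η k x) Filter.atTop (nhds (m x)) := by
  have hex : ∀ k : ℕ, ∃ g : EuclideanSpace ℝ (Fin d) → ℝ, ContDiff ℝ 2 g ∧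
      ∀ x, m x * (1 - 1 / ((k : ℝ) + 1)) < g x ∧ g x < m x := by
    intro k
    have hk : (0 : ℝ) < 1 / ((k : ℝ) + 1) := by positivity
    obtain ⟨g, hg⟩ := exists_contMDiffMap_forall_mem_convex_of_local_const (n := 2)
      (modelWithCornersSelf ℝ (EuclideanSpace ℝ (Fin d)))
      (t := fun x => Set.Ioo (m x * (1 - 1 / ((k : ℝ) + 1))) (m x))
      (fun x => convex_Ioo _ _) (by
        intro x
        have hlt : m x * (1 - 1 / ((k : ℝ) + 1)) < m x := by
          nlinarith [hpos x, mul_pos (hpos x) hk]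
        obtain ⟨c, hc1, hc2⟩ := exists_between hlt
        refine ⟨c, ?_⟩
        have h1 : ContinuousAt (fun y => m y * (1 - 1 / ((k : ℝ) + 1))) x := by fun_prop
        exact (h1.eventually_lt_const hc1).and (hm.continuousAt.eventually_const_lt hc2))
    exact ⟨g, g.contMDiff.contDiff, fun x => hg x⟩
  choose g hgC hg using hex
  -- The cutoff equals `1` on the ball of radius `k + 1`, so at each point it is eventually
  -- invisible.
  let χ : ∀ k : ℕ, ContDiffBump (0 : EuclideanSpace ℝ (Fin d)) := fun k =>
    ⟨(k : ℝ) + 1, (k : ℝ) + 2, by positivity, by linarith⟩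
  have hg0 : ∀ k x, 0 ≤ g k x := fun k x => by
    have h1 : 1 / ((k : ℝ) + 1) ≤ 1 := by
      rw [div_le_one (by positivity)]; linarith [(Nat.cast_nonneg k : (0 : ℝ) ≤ k)]
    exact (mul_nonneg (hpos x).le (sub_nonneg.2 h1)).trans (hg k x).1.le
  refine ⟨fun k x => χ k x * g k x, fun k => ⟨(χ k).contDiff.mul (hgC k),
    (χ k).hasCompactSupport.mul_right, fun x => ⟨mul_nonneg (χ k).nonneg (hg0 k x), ?_⟩⟩, ?_⟩
  · exact (mul_le_of_le_one_left (hg0 k x) (χ k).le_one).trans_lt (hg k x).2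
  · intro x
    have hlim : Filter.Tendsto (fun k : ℕ => m x * (1 - 1 / ((k : ℝ) + 1))) Filter.atTop
        (nhds (m x)) := by
      have := (tendsto_one_div_add_atTop_nhds_zero_nat (𝕜 := ℝ)).const_sub 1
      simpa using this.const_mul (m x)
    have hgl := tendsto_of_tendsto_of_tendsto_of_le_of_le hlim tendsto_const_nhds
      (fun k => (hg k x).1.le) (fun k => (hg k x).2.le)
    refine hgl.congr' ?_
    obtain ⟨K, hK⟩ := exists_nat_ge ‖x‖
    filter_upwards [Filter.eventually_ge_atTop K] with k hk
    have : χ k x = 1 := (χ k).one_of_mem_closedBall (by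
      rw [mem_closedBall_zero_iff]
      have : (K : ℝ) ≤ k := by exact_mod_cast hk
      change ‖x‖ ≤ (k : ℝ) + 1
      linarith)
    rw [this, one_mul]

/-- Bounds on the integrals of compactly supported minorants pass to the limit. -/
theorem integrable_and_integral_le_of_minorants {m ρ : EuclideanSpace ℝ (Fin d) → ℝ}
    (hm : Continuous m) (hpos : ∀ x, 0 < m x) (hρm : Measurable ρ) (hρ0 : ∀ x, 0 ≤ ρ x)
    (hρ : Integrable ρ volume) {B : ℝ}
    (hB : ∀ η : EuclideanSpace ℝ (Fin d) → ℝ, ContDiff ℝ 2 η → HasCompactSupport η →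
      (∀ x, 0 ≤ η x) → (∀ x, η x < m x) → ∫ x, η x * ρ x ≤ B) :
    Integrable (fun x => m x * ρ x) volume ∧ ∫ x, m x * ρ x ≤ B := by
  obtain ⟨η, hη, hlim⟩ := exists_seq_contDiff_lt hm hpos
  have hB0 : 0 ≤ B :=
    (integral_nonneg fun x => mul_nonneg ((hη 0).2.2 x).1 (hρ0 x)).trans
      (hB (η 0) (hη 0).1 (hη 0).2.1 (fun x => ((hη 0).2.2 x).1) fun x => ((hη 0).2.2 x).2)
  have hint : ∀ k, Integrable (fun x => η k x * ρ x) volume := by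
    intro k
    obtain ⟨K, hK⟩ := (hη k).2.1.exists_bound_of_continuous (hη k).1.continuous
    exact hρ.bdd_mul (hη k).1.continuous.aestronglyMeasurable (.of_forall hK)
  -- Fatou's lemma; it yields integrability of `m ρ` together with the bound.
  have hle : ∫⁻ x, ENNReal.ofReal (m x * ρ x) ≤ ENNReal.ofReal B := by
    have h1 : ∀ x, ENNReal.ofReal (m x * ρ x)
        = Filter.liminf (fun k => ENNReal.ofReal (η k x * ρ x)) Filter.atTop := fun x =>
      ((ENNReal.tendsto_ofReal ((hlim x).mul_const (ρ x))).liminf_eq).symm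
    simp only [h1]
    refine (lintegral_liminf_le (f := fun k x => ENNReal.ofReal (η k x * ρ x)) fun k =>
      ((hη k).1.continuous.measurable.mul hρm).ennreal_ofReal).trans ?_
    refine Filter.liminf_le_of_le (by isBoundedDefault) fun b hb => ?_
    obtain ⟨k, hk⟩ := hb.exists
    refine hk.trans ?_
    rw [← ofReal_integral_eq_lintegral_ofReal (hint k)
      (.of_forall fun x => mul_nonneg ((hη k).2.2 x).1 (hρ0 x))]
    exact ENNReal.ofReal_le_ofReal (hB (η k) (hη k).1 (hη k).2.1 (fun x => ((hη k).2.2 x).1)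
      fun x => ((hη k).2.2 x).2)
  have h0 : ∀ x, 0 ≤ m x * ρ x := fun x => mul_nonneg (hpos x).le (hρ0 x)
  have hi : Integrable (fun x => m x * ρ x) volume := by
    refine ⟨(hm.measurable.mul hρm).aestronglyMeasurable, ?_⟩
    rw [hasFiniteIntegral_iff_ofReal (.of_forall h0)]
    exact hle.trans_lt ENNReal.ofReal_lt_top
  refine ⟨hi, ?_⟩
  rw [← ofReal_integral_eq_lintegral_ofReal hi (.of_forall h0)] at hle
  exact (ENNReal.ofReal_le_ofReal_iff hB0).1 hle

end Approximation

/-! ### The parallel form, and an upper bound for the Hessian of the convolution. -/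

section QuadraticForms

variable {d : ℕ} {p q : EuclideanSpace ℝ (Fin d) → ℝ}

/-- The quadratic form of the matrix `parallelHessian p q x y`. -/
noncomputable def parallelForm (p q : EuclideanSpace ℝ (Fin d) → ℝ)
    (a x y : EuclideanSpace ℝ (Fin d)) : ℝ :=
  a.ofLp ⬝ᵥ (parallelHessian p q x y).mulVec a.ofLp

theorem posDef_parallelHessian (hp : IsRegularDensity p) (hq : IsRegularDensity q)
    (hφ : ∀ x u, u ≠ 0 → 0 < fderiv ℝ (fderiv ℝ (potential p)) x u u)
    (hψ : ∀ x u, u ≠ 0 → 0 < fderiv ℝ (fderiv ℝ (potential q)) x u u)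
    (x y : EuclideanSpace ℝ (Fin d)) : (parallelHessian p q x y).PosDef :=
  ((posDef_hessian hp.contDiff hφ x).inv.add (posDef_hessian hq.contDiff hψ y).inv).inv

theorem continuous_parallelHessian (hp : IsRegularDensity p) (hq : IsRegularDensity q)
    (hφ : ∀ x u, u ≠ 0 → 0 < fderiv ℝ (fderiv ℝ (potential p)) x u u)
    (hψ : ∀ x u, u ≠ 0 → 0 < fderiv ℝ (fderiv ℝ (potential q)) x u u) :
    Continuous fun w : EuclideanSpace ℝ (Fin d) × EuclideanSpace ℝ (Fin d) =>
      parallelHessian p q w.1 w.2 := by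
  have hA := posDef_hessian hp.contDiff hφ
  have hB := posDef_hessian hq.contDiff hψ
  have hu : ∀ {A : Matrix (Fin d) (Fin d) ℝ}, A.PosDef → IsUnit A.det := fun hA =>
    hA.isUnit.map Matrix.detMonoidHom
  unfold parallelHessian
  refine Continuous.matrix_inv_of_isUnit (Continuous.add ?_ ?_) fun w =>
    hu ((hA w.1).inv.add (hB w.2).inv)
  · exact Continuous.matrix_inv_of_isUnit ((continuous_hessian hp.contDiff).comp continuous_fst)
      fun w => hu (hA w.1)
  · exact Continuous.matrix_inv_of_isUnit ((continuous_hessian hq.contDiff).comp continuous_snd)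
      fun w => hu (hB w.2)

theorem continuous_parallelForm (hp : IsRegularDensity p) (hq : IsRegularDensity q)
    (hφ : ∀ x u, u ≠ 0 → 0 < fderiv ℝ (fderiv ℝ (potential p)) x u u)
    (hψ : ∀ x u, u ≠ 0 → 0 < fderiv ℝ (fderiv ℝ (potential q)) x u u)
    (a : EuclideanSpace ℝ (Fin d)) :
    Continuous fun w : EuclideanSpace ℝ (Fin d) × EuclideanSpace ℝ (Fin d) =>
      parallelForm p q a w.1 w.2 :=
  continuous_const.dotProduct
    ((continuous_parallelHessian hp hq hφ hψ).matrix_mulVec continuous_const)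

/-- The parallel-sum bound at the vector `h • a`: it places the parallel form below the Schur
complement, as the second-variation argument requires of `η`. -/
theorem parallelForm_mul_sq_le (hp : IsRegularDensity p) (hq : IsRegularDensity q)
    (hφ : ∀ x u, u ≠ 0 → 0 < fderiv ℝ (fderiv ℝ (potential p)) x u u)
    (hψ : ∀ x u, u ≠ 0 → 0 < fderiv ℝ (fderiv ℝ (potential q)) x u u)
    (a x y u : EuclideanSpace ℝ (Fin d)) (h : ℝ) :
    parallelForm p q a x y * h ^ 2 ≤ fderiv ℝ (fderiv ℝ (potential p)) x u u
      + fderiv ℝ (fderiv ℝ (potential q)) y (h • a - u) (h • a - u) := by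
  have key := (posDef_hessian hp.contDiff hφ x).parallelSum_le (posDef_hessian hq.contDiff hψ y)
    (h • a).ofLp u.ofLp
  rw [← WithLp.ofLp_sub, dotProduct_hessian_mulVec, dotProduct_hessian_mulVec] at key
  refine le_trans (le_of_eq ?_) key
  rw [WithLp.ofLp_smul, Matrix.mulVec_smul, smul_dotProduct, dotProduct_smul]
  simp only [parallelForm, parallelHessian, smul_eq_mul]
  ring

/-- Polarisation; it transfers integrability from quadratic forms to entries. -/
theorem Matrix.IsHermitian.two_mul_apply {n : Type*} [Fintype n] [DecidableEq n]
    {M : Matrix n n ℝ} (hM : M.IsHermitian) (i j : n) :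
    2 * M i j = (Pi.single i 1 + Pi.single j 1) ⬝ᵥ M.mulVec (Pi.single i 1 + Pi.single j 1)
      - Pi.single i 1 ⬝ᵥ M.mulVec (Pi.single i 1)
      - Pi.single j 1 ⬝ᵥ M.mulVec (Pi.single j 1) := by
  have : M j i = M i j := by simpa using hM.apply i j
  simp [Matrix.mulVec_add, add_dotProduct, dotProduct_add, this]
  ring

theorem two_mul_parallelHessian_apply (hp : IsRegularDensity p) (hq : IsRegularDensity q)
    (hφ : ∀ x u, u ≠ 0 → 0 < fderiv ℝ (fderiv ℝ (potential p)) x u u)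
    (hψ : ∀ x u, u ≠ 0 → 0 < fderiv ℝ (fderiv ℝ (potential q)) x u u)
    (x y : EuclideanSpace ℝ (Fin d)) (i j : Fin d) :
    parallelHessian p q x y i j = (1 / 2) * (parallelForm p q
        (EuclideanSpace.single i 1 + EuclideanSpace.single j 1) x y
      - parallelForm p q (EuclideanSpace.single i 1) x y
      - parallelForm p q (EuclideanSpace.single j 1) x y) := by
  have := (posDef_parallelHessian hp hq hφ hψ x y).isHermitian.two_mul_apply i j
  simp only [parallelForm, WithLp.ofLp_add, PiLp.ofLp_single]
  linarith

theorem second_deriv_potential_eq {f : EuclideanSpace ℝ (Fin d) → ℝ} (hf : ContDiff ℝ 2 f)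
    (hpos : ∀ x, 0 < f x) (z a : EuclideanSpace ℝ (Fin d)) :
    fderiv ℝ (fderiv ℝ (potential f)) z a a
      = (fderiv ℝ f z a) ^ 2 / f z ^ 2 - fderiv ℝ (fderiv ℝ f) z a a / f z := by
  have hΦ := contDiff_potential hf hpos
  have h1 : ∀ y, fderiv ℝ (potential f) y a = -(fderiv ℝ f y a / f y) := by
    intro y
    have h2 : HasFDerivAt (potential f) (-((f y)⁻¹ • fderiv ℝ f y)) y :=
      ((hf.differentiable (by norm_num) y).hasFDerivAt.log (hpos y).ne').neg
    rw [h2.fderiv]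
    simp only [neg_apply, smul_apply, smul_eq_mul]
    ring
  have h3 := hasDerivAt_fderiv_comp_line hΦ z a 0
  simp only [h1] at h3
  have h4 := ((hasDerivAt_fderiv_comp_line hf z a 0).div (hasDerivAt_comp_line hf z a 0)
    (hpos _).ne').neg
  have h5 := h3.unique h4
  simp only [zero_smul, add_zero] at h5
  rw [h5]
  have := (hpos z).ne'
  field_simp
  ring

theorem second_deriv_conv_apply (hp : ContDiff ℝ 1 p) (hp2 : MemLp p 2 volume)
    (hDp : MemLp (fderiv ℝ p) 2 volume) (hq : ContDiff ℝ 1 q) (hq2 : MemLp q 2 volume)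
    (hDq : MemLp (fderiv ℝ q) 2 volume) (z a : EuclideanSpace ℝ (Fin d)) :
    fderiv ℝ (fderiv ℝ (conv p q)) z a a = ∫ x, fderiv ℝ q x a * fderiv ℝ p (z - x) a := by
  have hd : Differentiable ℝ (fderiv ℝ (conv p q)) :=
    ((contDiff_two_conv hp hp2 hDp hq hq2 hDq).fderiv_right (m := 1)
      (by norm_num)).differentiable (by norm_num)
  have h1 : HasFDerivAt (fun y => fderiv ℝ (conv p q) y a)
      ((fderiv ℝ (fderiv ℝ (conv p q)) z).flip a) z := by
    simpa using (hd z).hasFDerivAt.clm_apply (hasFDerivAt_const a z)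
  have h2 := h1.unique (hasFDerivAt_fderiv_conv_apply hp hp2 hDp hq hq2 hDq z a)
  have h3 := DFunLike.congr_fun h2 a
  rw [integral_smul_comp_sub_apply (memLp_clm_apply hDq a) hDp] at h3
  exact h3

theorem IsRegularDensity.integrable_sq_fderiv_mul (hp : IsRegularDensity p)
    (a : EuclideanSpace ℝ (Fin d)) :
    Integrable (fun x => fderiv ℝ (potential p) x a ^ 2 * p x) volume := by
  have h1 : Continuous (fderiv ℝ (potential p)) := hp.contDiff.continuous_fderiv (by norm_num)
  have h2 := hp.contDiff_self.continuous
  refine (hp.fisher.const_mul (‖a‖ ^ 2)).mono'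
    (((h1.clm_apply continuous_const).pow 2).mul h2).aestronglyMeasurable (.of_forall fun x => ?_)
  rw [Real.norm_of_nonneg (mul_nonneg (sq_nonneg _) (hp.pos x).le), ← mul_assoc, gradient,
    LinearIsometryEquiv.norm_map, ← mul_pow, mul_comm ‖a‖, ← sq_abs]
  have := (fderiv ℝ (potential p) x).le_opNorm a
  rw [Real.norm_eq_abs] at this
  exact mul_le_mul_of_nonneg_right (by gcongr) (hp.pos x).le

theorem integrable_mul_comp_sub_of_le {f : EuclideanSpace ℝ (Fin d) → ℝ}
    (hf : Integrable f volume) (hqd : IsDensity q) {C : ℝ} (hqC : ∀ x, q x ≤ C)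
    (z : EuclideanSpace ℝ (Fin d)) : Integrable (fun x => f x * q (z - x)) volume :=
  hf.mul_bdd (c := C) (hqd.measurable.comp (measurable_const.sub measurable_id)).aestronglyMeasurable
    (.of_forall fun x => by rw [Real.norm_of_nonneg (hqd.nonneg _)]; exact hqC _)

/-- A bound on the second derivative of the potential of a convolution by integrable
convolutions. -/
theorem conv_mul_second_deriv_potential_le (hp : IsRegularDensity p) (hq : IsRegularDensity q)
    (hpd : IsDensity p) (hqd : IsDensity q) {C : ℝ} (hpC : ∀ x, p x ≤ C) (hqC : ∀ x, q x ≤ C)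
    (z a : EuclideanSpace ℝ (Fin d)) :
    conv p q z * fderiv ℝ (fderiv ℝ (potential (conv p q))) z a a
      ≤ conv (fun x => fderiv ℝ (potential p) x a ^ 2 * p x) q z
        + conv (fun x => |fderiv ℝ q x a|) (fun x => |fderiv ℝ p x a|) z := by
  have hp1 : ContDiff ℝ 1 p := hp.contDiff_self.of_le (by norm_num)
  have hq1 : ContDiff ℝ 1 q := hq.contDiff_self.of_le (by norm_num)
  have hp2 := hpd.memLp_two hpC
  have hq2 := hqd.memLp_two hqC
  have hDp := hp.memLp_two_fderiv hpC
  have hDq := hq.memLp_two_fderiv hqC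
  have hint : Integrable (fun x => p x * q (z - x)) volume := integrable_smul_comp_sub hp2 hq2 z
  have hpos : ∀ y, 0 < conv p q y := fun y =>
    conv_pos hp.pos hq.pos y (integrable_smul_comp_sub hp2 hq2 y)
  rw [second_deriv_potential_eq (contDiff_two_conv hp1 hp2 hDp hq1 hq2 hDq) hpos,
    second_deriv_conv_apply hp1 hp2 hDp hq1 hq2 hDq]
  set Z := conv p q z with hZ
  have hZ0 : 0 < Z := hpos z
  set D := fderiv ℝ (conv p q) z a with hD
  have hmul : Z * (D ^ 2 / Z ^ 2 - (∫ x, fderiv ℝ q x a * fderiv ℝ p (z - x) a) / Z)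
      = D ^ 2 / Z - ∫ x, fderiv ℝ q x a * fderiv ℝ p (z - x) a := by
    field_simp
  rw [hmul]
  have hB : -(∫ x, fderiv ℝ q x a * fderiv ℝ p (z - x) a)
      ≤ conv (fun x => |fderiv ℝ q x a|) (fun x => |fderiv ℝ p x a|) z := by
    refine (neg_le_abs _).trans (abs_integral_le_integral_abs.trans (le_of_eq ?_))
    rw [conv_apply]
    simp only [abs_mul]
  have hDeq : D = -∫ x, fderiv ℝ (potential p) x a * (p x * q (z - x)) := by
    rw [hD, conv_comm, fderiv_conv_apply hq2 hp1 hp2 hDp, ← integral_neg]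
    refine integral_congr_ae (.of_forall fun x => ?_)
    simp only [(hp.hasFDerivAt x).fderiv, neg_apply, smul_apply, smul_eq_mul]
    ring
  have hsint : Integrable (fun x => fderiv ℝ (potential p) x a * (p x * q (z - x))) volume := by
    have := (integrable_smul_comp_sub (memLp_clm_apply hDp a) hq2 z).neg
    refine this.congr (.of_forall fun x => ?_)
    simp only [(hp.hasFDerivAt x).fderiv, Pi.neg_apply, neg_apply, smul_apply, smul_eq_mul]
    ring
  have hs2int := integrable_mul_comp_sub_of_le (hp.integrable_sq_fderiv_mul a) hqd hqC z
  -- `-D / Z` is the conditional mean of `∂ₐφ`, and the integral below is `Z` times its conditional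
  -- variance, so this is Cauchy–Schwarz.
  have hA : D ^ 2 / Z ≤ conv (fun x => fderiv ℝ (potential p) x a ^ 2 * p x) q z := by
    have h0 : 0 ≤ ∫ x, (fderiv ℝ (potential p) x a + D / Z) ^ 2 * (p x * q (z - x)) :=
      integral_nonneg fun x => mul_nonneg (sq_nonneg _) (mul_pos (hp.pos _) (hq.pos _)).le
    have h1 : ∫ x, (fderiv ℝ (potential p) x a + D / Z) ^ 2 * (p x * q (z - x))
        = conv (fun x => fderiv ℝ (potential p) x a ^ 2 * p x) q z
          + (2 * (D / Z)) * (∫ x, fderiv ℝ (potential p) x a * (p x * q (z - x)))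
          + (D / Z) ^ 2 * Z := by
      have h12 : Integrable (fun x => fderiv ℝ (potential p) x a ^ 2 * p x * q (z - x)
          + 2 * (D / Z) * (fderiv ℝ (potential p) x a * (p x * q (z - x)))) volume :=
        hs2int.add (hsint.const_mul _)
      have e : (fun x => (fderiv ℝ (potential p) x a + D / Z) ^ 2 * (p x * q (z - x)))
          = fun x => fderiv ℝ (potential p) x a ^ 2 * p x * q (z - x)
          + 2 * (D / Z) * (fderiv ℝ (potential p) x a * (p x * q (z - x)))
          + (D / Z) ^ 2 * (p x * q (z - x)) := by
        ext x; ring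
      rw [e, integral_add h12 (hint.const_mul _), integral_add hs2int (hsint.const_mul _),
        integral_const_mul, integral_const_mul]
      rfl
    rw [h1, show ∫ x, fderiv ℝ (potential p) x a * (p x * q (z - x)) = -D by rw [hDeq, neg_neg]]
      at h0
    have h2 : (2 * (D / Z)) * -D + (D / Z) ^ 2 * Z = -(D ^ 2 / Z) := by field_simp; ring
    linarith
  linarith

end QuadraticForms

/-! ### Joint law of the summands and conditioning on the sum. -/

section JointLaw

variable {d : ℕ} {Ω : Type*} [MeasurableSpace Ω] {P : Measure Ω} [IsProbabilityMeasure P]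
  {X Y : Ω → EuclideanSpace ℝ (Fin d)} {p q : EuclideanSpace ℝ (Fin d) → ℝ}

theorem map_prodMk_eq_withDensity (hX : Measurable X) (hY : Measurable Y) (hXY : IndepFun X Y P)
    (hp : IsDensity p) (hq : IsDensity q) (hXp : HasDensity P X p) (hYq : HasDensity P Y q) :
    P.map (fun ω => (X ω, Y ω)) = ((volume : Measure (EuclideanSpace ℝ (Fin d))).prod
      volume).withDensity (fun w => ENNReal.ofReal (p w.1 * q w.2)) := by
  rw [(indepFun_iff_map_prod_eq_prod_map_map hX.aemeasurable hY.aemeasurable).1 hXY,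
    show P.map X = _ from hXp, show P.map Y = _ from hYq,
    prod_withDensity hp.measurable.ennreal_ofReal hq.measurable.ennreal_ofReal]
  congr 1
  ext w
  rw [ENNReal.ofReal_mul (hp.nonneg _)]

theorem measurable_mul_density (hp : IsDensity p) (hq : IsDensity q) :
    Measurable fun w : EuclideanSpace ℝ (Fin d) × EuclideanSpace ℝ (Fin d) => p w.1 * q w.2 :=
  (hp.measurable.comp measurable_fst).mul (hq.measurable.comp measurable_snd)

/-- The volume-preserving change of variables `(z, x) ↦ (x, z - x)`: in these coordinates the first
variable is the value of the sum, and conditioning becomes integration in `x`. -/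
theorem integrable_comp_prodMk_iff (hX : Measurable X) (hY : Measurable Y) (hXY : IndepFun X Y P)
    (hp : IsDensity p) (hq : IsDensity q) (hXp : HasDensity P X p) (hYq : HasDensity P Y q)
    {F : EuclideanSpace ℝ (Fin d) × EuclideanSpace ℝ (Fin d) → ℝ} (hF : Measurable F) :
    Integrable (fun ω => F (X ω, Y ω)) P ↔
      Integrable (fun w : EuclideanSpace ℝ (Fin d) × EuclideanSpace ℝ (Fin d) =>
        F (w.2, w.1 - w.2) * (p w.2 * q (w.1 - w.2))) (volume.prod volume) := by
  have hρ := measurable_mul_density hp hq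
  have h1 := integrable_map_measure (μ := P) (f := fun ω => (X ω, Y ω)) (g := F)
    hF.aestronglyMeasurable (hX.prodMk hY).aemeasurable
  rw [map_prodMk_eq_withDensity hX hY hXY hp hq hXp hYq,
    integrable_withDensity_iff hρ.ennreal_ofReal (.of_forall fun _ => ENNReal.ofReal_lt_top)] at h1
  have hT := measurePreserving_prod_sub_swap (volume : Measure (EuclideanSpace ℝ (Fin d)))
    (volume : Measure (EuclideanSpace ℝ (Fin d)))
  have h2 := hT.integrable_comp (g := fun w => F w * (ENNReal.ofReal (p w.1 * q w.2)).toReal)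
    (hF.mul hρ.ennreal_ofReal.ennreal_toReal).aestronglyMeasurable
  refine (h1.symm.trans h2.symm).trans (integrable_congr (.of_forall fun w => ?_))
  simp only [Function.comp_apply]
  rw [ENNReal.toReal_ofReal (mul_nonneg (hp.nonneg _) (hq.nonneg _))]

theorem integral_comp_prodMk (hX : Measurable X) (hY : Measurable Y) (hXY : IndepFun X Y P)
    (hp : IsDensity p) (hq : IsDensity q) (hXp : HasDensity P X p) (hYq : HasDensity P Y q)
    {F : EuclideanSpace ℝ (Fin d) × EuclideanSpace ℝ (Fin d) → ℝ} (hF : Measurable F) :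
    ∫ ω, F (X ω, Y ω) ∂P =
      ∫ w : EuclideanSpace ℝ (Fin d) × EuclideanSpace ℝ (Fin d),
        F (w.2, w.1 - w.2) * (p w.2 * q (w.1 - w.2)) ∂(volume.prod volume) := by
  have hρ := measurable_mul_density hp hq
  rw [← integral_map (φ := fun ω => (X ω, Y ω)) (hX.prodMk hY).aemeasurable
    hF.aestronglyMeasurable, map_prodMk_eq_withDensity hX hY hXY hp hq hXp hYq,
    integral_withDensity_eq_integral_toReal_smul hρ.ennreal_ofReal
      (.of_forall fun _ => ENNReal.ofReal_lt_top)]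
  have hT := measurePreserving_prod_sub_swap (volume : Measure (EuclideanSpace ℝ (Fin d)))
    (volume : Measure (EuclideanSpace ℝ (Fin d)))
  conv_lhs => rw [← hT.map_eq]
  have hm : Measurable fun w : EuclideanSpace ℝ (Fin d) × EuclideanSpace ℝ (Fin d) =>
      (ENNReal.ofReal (p w.1 * q w.2)).toReal • F w := hρ.ennreal_ofReal.ennreal_toReal.smul hF
  rw [integral_map hT.measurable.aemeasurable hm.aestronglyMeasurable]
  refine integral_congr_ae (.of_forall fun w => ?_)
  simp only [smul_eq_mul]
  rw [ENNReal.toReal_ofReal (mul_nonneg (hp.nonneg _) (hq.nonneg _)), mul_comm]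

/-- The conditional expectation given the sum of two independent random vectors with densities. -/
theorem condExp_comp_prodMk (hX : Measurable X) (hY : Measurable Y) (hXY : IndepFun X Y P)
    (hp : IsDensity p) (hq : IsDensity q) (hXp : HasDensity P X p) (hYq : HasDensity P Y q)
    (hZ : HasDensity P (fun ω => X ω + Y ω) (conv p q)) (hpos : ∀ z, 0 < conv p q z)
    {F : EuclideanSpace ℝ (Fin d) × EuclideanSpace ℝ (Fin d) → ℝ} (hF : Measurable F)
    (hint : Integrable (fun w : EuclideanSpace ℝ (Fin d) × EuclideanSpace ℝ (Fin d) =>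
        F (w.2, w.1 - w.2) * (p w.2 * q (w.1 - w.2))) (volume.prod volume)) :
    P[fun ω => F (X ω, Y ω) | MeasurableSpace.comap (fun ω => X ω + Y ω) inferInstance] =ᵐ[P]
      fun ω => (∫ x, F (x, X ω + Y ω - x) * (p x * q (X ω + Y ω - x))) / conv p q (X ω + Y ω) := by
  have hS : Measurable fun ω => X ω + Y ω := hX.add hY
  have hcm : Measurable (conv p q) := measurable_conv hp.measurable hq.measurable
  set G : EuclideanSpace ℝ (Fin d) → ℝ := fun z => ∫ x, F (x, z - x) * (p x * q (z - x)) with hG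
  have hGm : Measurable G := by
    have hk : Measurable fun w : EuclideanSpace ℝ (Fin d) × EuclideanSpace ℝ (Fin d) =>
        F (w.2, w.1 - w.2) * (p w.2 * q (w.1 - w.2)) := by
      have := hp.measurable
      have := hq.measurable
      fun_prop
    exact hk.stronglyMeasurable.integral_prod_right.measurable
  have hHm : Measurable fun z => G z / conv p q z := hGm.div hcm
  have hGi : Integrable G volume := hint.integral_prod_left
  have hdiv : ∀ z, G z / conv p q z * (ENNReal.ofReal (conv p q z)).toReal = G z := fun z => by
    rw [ENNReal.toReal_ofReal (hpos z).le, div_mul_cancel₀ _ (hpos z).ne']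
  have hHi : Integrable (fun ω => G (X ω + Y ω) / conv p q (X ω + Y ω)) P := by
    refine (integrable_map_measure (μ := P) (f := fun ω => X ω + Y ω)
      (g := fun z => G z / conv p q z) hHm.aestronglyMeasurable hS.aemeasurable).1 ?_
    rw [show P.map (fun ω => X ω + Y ω) = _ from hZ, integrable_withDensity_iff hcm.ennreal_ofReal
      (.of_forall fun _ => ENNReal.ofReal_lt_top)]
    simpa only [hdiv] using hGi
  refine (ae_eq_condExp_of_forall_setIntegral_eq hS.comap_le
    ((integrable_comp_prodMk_iff hX hY hXY hp hq hXp hYq hF).2 hint)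
    (fun s _ _ => hHi.integrableOn) ?_ ?_).symm
  · rintro _ ⟨s, hs, rfl⟩ -
    have h1 : ∫ ω in (fun ω => X ω + Y ω) ⁻¹' s, G (X ω + Y ω) / conv p q (X ω + Y ω) ∂P
        = ∫ z in s, G z := by
      rw [← setIntegral_map (μ := P) (g := fun ω => X ω + Y ω) (f := fun z => G z / conv p q z) hs
        hHm.aestronglyMeasurable hS.aemeasurable, show P.map (fun ω => X ω + Y ω) = _ from hZ,
        setIntegral_withDensity_eq_setIntegral_toReal_smul hcm.ennreal_ofReal
          (.of_forall fun _ => ENNReal.ofReal_lt_top) _ hs]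
      refine setIntegral_congr_fun hs fun z _ => ?_
      simp only [smul_eq_mul]
      rw [mul_comm, hdiv]
    have h2 : ∫ ω in (fun ω => X ω + Y ω) ⁻¹' s, F (X ω, Y ω) ∂P = ∫ z in s, G z := by
      -- The event `X + Y ∈ s` is absorbed in the integrand; in the new coordinates its indicator
      -- depends on `w.1` alone and comes out of the inner integral.
      set I : EuclideanSpace ℝ (Fin d) × EuclideanSpace ℝ (Fin d) → ℝ :=
        fun w => s.indicator (fun _ => (1 : ℝ)) (w.1 + w.2) * F w with hI
      have hIm : Measurable I :=
        ((measurable_const.indicator hs).comp (measurable_fst.add measurable_snd)).mul hF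
      have h3 : ∫ ω in (fun ω => X ω + Y ω) ⁻¹' s, F (X ω, Y ω) ∂P = ∫ ω, I (X ω, Y ω) ∂P := by
        rw [← integral_indicator (hS hs)]
        refine integral_congr_ae (.of_forall fun ω => ?_)
        by_cases h : X ω + Y ω ∈ s
        · have h' : ω ∈ (fun ω => X ω + Y ω) ⁻¹' s := h
          simp [hI, h, h']
        · have h' : ω ∉ (fun ω => X ω + Y ω) ⁻¹' s := h
          simp [hI, h, h']
      rw [h3, integral_comp_prodMk hX hY hXY hp hq hXp hYq hIm, ← integral_indicator hs]
      have h4 : ∀ w : EuclideanSpace ℝ (Fin d) × EuclideanSpace ℝ (Fin d),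
          I (w.2, w.1 - w.2) * (p w.2 * q (w.1 - w.2))
            = s.indicator (fun _ => (1 : ℝ)) w.1
              * (F (w.2, w.1 - w.2) * (p w.2 * q (w.1 - w.2))) := by
        intro w
        simp only [hI, add_sub_cancel]
        ring
      simp only [h4]
      have hm : Measurable fun w : EuclideanSpace ℝ (Fin d) × EuclideanSpace ℝ (Fin d) =>
          s.indicator (fun _ => (1 : ℝ)) w.1 :=
        (measurable_const.indicator hs).comp measurable_fst
      have hind : Integrable (fun w : EuclideanSpace ℝ (Fin d) × EuclideanSpace ℝ (Fin d) =>
          s.indicator (fun _ => (1 : ℝ)) w.1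
            * (F (w.2, w.1 - w.2) * (p w.2 * q (w.1 - w.2)))) (volume.prod volume) :=
        hint.bdd_mul (c := 1) hm.aestronglyMeasurable (.of_forall fun w => by
          simp only [Set.indicator]; split_ifs <;> simp)
      rw [integral_prod _ hind]
      refine integral_congr_ae (.of_forall fun z => ?_)
      simp only [Set.indicator, hG]
      split_ifs <;> simp
    rw [h1, h2]
  · exact (hHm.comp (comap_measurable _)).aestronglyMeasurable

end JointLaw

/-! ### The Hessian bound for quadratic forms, and integrability over the joint law. -/

section HessianBound

variable {d : ℕ} {p q : EuclideanSpace ℝ (Fin d) → ℝ}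

/-- The Hessian bound tested against a vector. -/
theorem integrable_parallelForm_mul (hp : IsRegularDensity p) (hq : IsRegularDensity q)
    (hpd : IsDensity p) (hqd : IsDensity q) {C : ℝ} (hpC : ∀ x, p x ≤ C) (hqC : ∀ x, q x ≤ C)
    (hφ : ∀ x u, u ≠ 0 → 0 < fderiv ℝ (fderiv ℝ (potential p)) x u u)
    (hψ : ∀ x u, u ≠ 0 → 0 < fderiv ℝ (fderiv ℝ (potential q)) x u u)
    (hZ : ContDiff ℝ 2 (potential (conv p q))) (z a : EuclideanSpace ℝ (Fin d)) :
    Integrable (fun x => parallelForm p q a x (z - x) * (p x * q (z - x))) volume ∧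
      ∫ x, parallelForm p q a x (z - x) * (p x * q (z - x))
        ≤ conv p q z * fderiv ℝ (fderiv ℝ (potential (conv p q))) z a a := by
  -- Approximation from strictly below needs a strictly positive form, so `a = 0` is separate.
  rcases eq_or_ne a 0 with rfl | ha
  · simp [parallelForm]
  have hint : ∀ y, Integrable (fun x => p x * q (y - x)) volume := fun y =>
    integrable_smul_comp_sub (hpd.memLp_two hpC) (hqd.memLp_two hqC) y
  have hpos : 0 < conv p q z := conv_pos hp.pos hq.pos z (hint z)
  have hpm := hpd.measurable
  have hqm := hqd.measurable
  refine integrable_and_integral_le_of_minorants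
    ((continuous_parallelForm hp hq hφ hψ a).comp (by fun_prop : Continuous fun x => (x, z - x)))
    (fun x => ?_) (by fun_prop) (fun x => (mul_pos (hp.pos _) (hq.pos _)).le) (hint z) ?_
  · have := (posDef_parallelHessian hp hq hφ hψ x (z - x)).dotProduct_mulVec_pos
      (x := a.ofLp) (by simpa using ha)
    rwa [star_trivial] at this
  · intro η hη hηc _ hlt
    have key := integral_div_conv_le_second_deriv hp hq hpd hqd hpC hqC hZ hη hηc hφ hψ z a
      fun x u h hh => (mul_lt_mul_of_pos_right (hlt x) (by positivity)).trans_le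
        (parallelForm_mul_sq_le hp hq hφ hψ a x (z - x) u h)
    rwa [div_le_iff₀' hpos] at key

/-- For each `z` the inner integral is at most the weighted second derivative of `-log (p ⋆ q)`,
which is in turn at most a sum of convolutions of integrable functions. This bound is integrable in
`z`, although nothing bounds `M` itself. -/
theorem integrable_prod_parallelForm_mul (hp : IsRegularDensity p) (hq : IsRegularDensity q)
    (hpd : IsDensity p) (hqd : IsDensity q) {C : ℝ} (hpC : ∀ x, p x ≤ C) (hqC : ∀ x, q x ≤ C)
    (hφ : ∀ x u, u ≠ 0 → 0 < fderiv ℝ (fderiv ℝ (potential p)) x u u)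
    (hψ : ∀ x u, u ≠ 0 → 0 < fderiv ℝ (fderiv ℝ (potential q)) x u u)
    (hZ : ContDiff ℝ 2 (potential (conv p q))) (a : EuclideanSpace ℝ (Fin d)) :
    Integrable (fun w : EuclideanSpace ℝ (Fin d) × EuclideanSpace ℝ (Fin d) =>
      parallelForm p q a w.2 (w.1 - w.2) * (p w.2 * q (w.1 - w.2))) (volume.prod volume) := by
  have hpm := hpd.measurable
  have hqm := hqd.measurable
  have hform : Measurable fun w : EuclideanSpace ℝ (Fin d) × EuclideanSpace ℝ (Fin d) =>
      parallelForm p q a w.2 (w.1 - w.2) :=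
    ((continuous_parallelForm hp hq hφ hψ a).comp
      (by fun_prop : Continuous fun w : EuclideanSpace ℝ (Fin d) × EuclideanSpace ℝ (Fin d) =>
        (w.2, w.1 - w.2))).measurable
  have hm : Measurable fun w : EuclideanSpace ℝ (Fin d) × EuclideanSpace ℝ (Fin d) =>
      parallelForm p q a w.2 (w.1 - w.2) * (p w.2 * q (w.1 - w.2)) := by fun_prop
  have hmain := fun z => integrable_parallelForm_mul hp hq hpd hqd hpC hqC hφ hψ hZ z a
  have h0 : ∀ x y, 0 ≤ parallelForm p q a x y * (p x * q y) := fun x y => by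
    refine mul_nonneg ?_ (mul_pos (hp.pos _) (hq.pos _)).le
    have := (posDef_parallelHessian hp hq hφ hψ x y).posSemidef.dotProduct_mulVec_nonneg a.ofLp
    rwa [star_trivial] at this
  refine (integrable_prod_iff hm.aestronglyMeasurable).2 ⟨.of_forall fun z => (hmain z).1, ?_⟩
  have hB : Integrable (fun z => conv (fun x => fderiv ℝ (potential p) x a ^ 2 * p x) q z
      + conv (fun x => |fderiv ℝ q x a|) (fun x => |fderiv ℝ p x a|) z) volume :=
    ((hp.integrable_sq_fderiv_mul a).integrable_convolution _ hqd.integrable).add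
      (((hq.integrable_fderiv hqd).apply_continuousLinearMap a).abs.integrable_convolution _
        ((hp.integrable_fderiv hpd).apply_continuousLinearMap a).abs)
  refine hB.mono' hm.norm.stronglyMeasurable.integral_prod_right.aestronglyMeasurable
    (.of_forall fun z => ?_)
  have e : ∫ x, ‖parallelForm p q a x (z - x) * (p x * q (z - x))‖
      = ∫ x, parallelForm p q a x (z - x) * (p x * q (z - x)) := by
    simp only [Real.norm_of_nonneg (h0 _ _)]
  dsimp only
  rw [e, Real.norm_of_nonneg (integral_nonneg fun x => h0 _ _)]
  exact (hmain z).2.trans (conv_mul_second_deriv_potential_le hp hq hpd hqd hpC hqC z a)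

theorem dotProduct_condMeanGivenSum_mulVec
    {M : EuclideanSpace ℝ (Fin d) → EuclideanSpace ℝ (Fin d) → Matrix (Fin d) (Fin d) ℝ}
    {z : EuclideanSpace ℝ (Fin d)}
    (hM : ∀ i j, Integrable (fun x => M x (z - x) i j * (p x * q (z - x))) volume)
    (a : Fin d → ℝ) :
    a ⬝ᵥ (condMeanGivenSum p q M z).mulVec a
      = (∫ x, (a ⬝ᵥ (M x (z - x)).mulVec a) * (p x * q (z - x))) / conv p q z := by
  have e : ∀ x, (a ⬝ᵥ (M x (z - x)).mulVec a) * (p x * q (z - x))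
      = ∑ i, ∑ j, a i * a j * (M x (z - x) i j * (p x * q (z - x))) := by
    intro x
    simp only [dotProduct, Matrix.mulVec, Finset.mul_sum, Finset.sum_mul]
    refine Finset.sum_congr rfl fun i _ => Finset.sum_congr rfl fun j _ => ?_
    ring
  simp only [e]
  rw [integral_finsetSum _ fun i _ => integrable_finsetSum _ fun j _ => (hM i j).const_mul _]
  simp only [integral_finsetSum _ fun j _ => (hM _ j).const_mul _, integral_const_mul,
    dotProduct, Matrix.mulVec, condMeanGivenSum, Matrix.of_apply, Finset.mul_sum, Finset.sum_div]
  refine Finset.sum_congr rfl fun i _ => Finset.sum_congr rfl fun j _ => ?_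
  ring

theorem isHermitian_condMeanGivenSum
    {M : EuclideanSpace ℝ (Fin d) → EuclideanSpace ℝ (Fin d) → Matrix (Fin d) (Fin d) ℝ}
    (hM : ∀ x y, (M x y).IsHermitian) (z : EuclideanSpace ℝ (Fin d)) :
    (condMeanGivenSum p q M z).IsHermitian := by
  ext i j
  have h : ∀ x, M x (z - x) j i = M x (z - x) i j := fun x => by
    simpa using (hM x (z - x)).apply i j
  simp only [Matrix.conjTranspose_apply, star_trivial, condMeanGivenSum, Matrix.of_apply, h]

end HessianBound

/-! ### The main theorem. -/

theorem mainTheorem7 {d : ℕ} {Ω : Type*} [MeasurableSpace Ω] (P : Measure Ω)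
    [IsProbabilityMeasure P] (σ τ : ℝ) (hσ : 0 < σ) (hτ : 0 < τ)
    (X Y : Ω → EuclideanSpace ℝ (Fin d)) (hX : Measurable X) (hY : Measurable Y)
    (hXY : IndepFun X Y P) (p q : EuclideanSpace ℝ (Fin d) → ℝ)
    (hXp : HasDensity P X p) (hYq : HasDensity P Y q)
    (hp : p ∈ SLC1 (σ ^ 2) d) (hq : q ∈ SLC1 (τ ^ 2) d) :
    -- `X + Y` has the density `p ⋆ q`, which is defined at every point and strongly log-concave
    (ConvolutionExists p q (ContinuousLinearMap.mul ℝ ℝ) volume ∧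
      HasDensity P (fun ω => X ω + Y ω) (conv p q) ∧
      conv p q ∈ SLC1 (σ ^ 2 + τ ^ 2) d) ∧
    -- the Hessian bound for regular densities
    (IsRegularDensity p → IsRegularDensity q →
      ((∀ z, 0 < conv p q z) ∧ ContDiff ℝ 2 (potential (conv p q))) ∧
      (∀ z, (∀ i j, Integrable
          (fun x => parallelHessian p q x (z - x) i j * (p x * q (z - x))) volume) ∧
        (hessian (potential (conv p q)) z
          - condMeanGivenSum p q (parallelHessian p q) z).PosSemidef) ∧
      -- `condMeanGivenSum` is a version of the conditional expectation given `X + Y`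
      (∀ i j, Integrable (fun ω => parallelHessian p q (X ω) (Y ω) i j) P ∧
        P[fun ω => parallelHessian p q (X ω) (Y ω) i j |
            MeasurableSpace.comap (fun ω => X ω + Y ω) inferInstance] =ᵐ[P]
          fun ω => condMeanGivenSum p q (parallelHessian p q) (X ω + Y ω) i j)) := by
  have hσ2 : 0 < σ ^ 2 := by positivity
  have hτ2 : 0 < τ ^ 2 := by positivity
  have hpd := hp.1
  have hqd := hq.1
  obtain ⟨C₁, hC₁⟩ := (isLogConcave_of_mem_SLC1 hσ2 hp).exists_le_of_isDensity hpd
  obtain ⟨C₂, hC₂⟩ := (isLogConcave_of_mem_SLC1 hτ2 hq).exists_le_of_isDensity hqd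
  have hpC : ∀ x, p x ≤ max C₁ C₂ := fun x => (hC₁ x).trans (le_max_left _ _)
  have hqC : ∀ x, q x ≤ max C₁ C₂ := fun x => (hC₂ x).trans (le_max_right _ _)
  have hint : ∀ z, Integrable (fun x => p x * q (z - x)) volume := fun z =>
    integrable_mul_comp_sub_of_le hpd.integrable hqd hqC z
  have hZd := hasDensity_add hX hY hXY hpd hqd hXp hYq hint
  refine ⟨⟨hint, hZd, conv_mem_SLC1 hσ2 hτ2 hp hq hint⟩, fun hpr hqr => ?_⟩
  have hpos : ∀ z, 0 < conv p q z := fun z => conv_pos hpr.pos hqr.pos z (hint z)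
  have hZ : ContDiff ℝ 2 (potential (conv p q)) :=
    contDiff_potential (contDiff_two_conv (hpr.contDiff_self.of_le (by norm_num))
      (hpd.memLp_two hpC) (hpr.memLp_two_fderiv hpC) (hqr.contDiff_self.of_le (by norm_num))
      (hqd.memLp_two hqC) (hqr.memLp_two_fderiv hqC)) hpos
  have hφ := second_deriv_potential_pos hσ2 hp hpr
  have hψ := second_deriv_potential_pos hτ2 hq hqr
  have hmain := fun z a => integrable_parallelForm_mul hpr hqr hpd hqd hpC hqC hφ hψ hZ z a
  have hentry : ∀ z i j, Integrable
      (fun x => parallelHessian p q x (z - x) i j * (p x * q (z - x))) volume := by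
    intro z i j
    -- Entries are recovered by polarisation from the forms at `eᵢ + eⱼ`, `eᵢ` and `eⱼ`.
    refine (((((hmain z (EuclideanSpace.single i 1 + EuclideanSpace.single j 1)).1.sub
      (hmain z (EuclideanSpace.single i 1)).1).sub
      (hmain z (EuclideanSpace.single j 1)).1)).const_mul (1 / 2)).congr (.of_forall fun x => ?_)
    simp only [two_mul_parallelHessian_apply hpr hqr hφ hψ, Pi.sub_apply]
    ring
  refine ⟨⟨hpos, hZ⟩, fun z => ⟨hentry z, ?_⟩, fun i j => ?_⟩
  · refine Matrix.PosSemidef.of_dotProduct_mulVec_nonneg ((isHermitian_hessian hZ z).sub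
      (isHermitian_condMeanGivenSum
        (fun x y => (posDef_parallelHessian hpr hqr hφ hψ x y).isHermitian) z)) fun a => ?_
    rw [star_trivial, Matrix.sub_mulVec, dotProduct_sub,
      dotProduct_condMeanGivenSum_mulVec (hentry z), sub_nonneg, div_le_iff₀' (hpos z)]
    have h1 := dotProduct_hessian_mulVec (potential (conv p q)) z (WithLp.toLp 2 a)
      (WithLp.toLp 2 a)
    rw [show a ⬝ᵥ (hessian (potential (conv p q)) z).mulVec a = _ from h1]
    exact (hmain z (WithLp.toLp 2 a)).2
  · have hF : Measurable fun w : EuclideanSpace ℝ (Fin d) × EuclideanSpace ℝ (Fin d) =>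
        parallelHessian p q w.1 w.2 i j :=
      ((continuous_parallelHessian hpr hqr hφ hψ).matrix_elem i j).measurable
    have hprod := fun a =>
      integrable_prod_parallelForm_mul hpr hqr hpd hqd hpC hqC hφ hψ hZ a
    have hFint : Integrable (fun w : EuclideanSpace ℝ (Fin d) × EuclideanSpace ℝ (Fin d) =>
        parallelHessian p q w.2 (w.1 - w.2) i j * (p w.2 * q (w.1 - w.2)))
        (volume.prod volume) := by
      refine (((((hprod (EuclideanSpace.single i 1 + EuclideanSpace.single j 1)).sub
        (hprod (EuclideanSpace.single i 1))).sub
        (hprod (EuclideanSpace.single j 1)))).const_mul (1 / 2)).congr (.of_forall fun w => ?_)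
      simp only [two_mul_parallelHessian_apply hpr hqr hφ hψ, Pi.sub_apply]
      ring
    exact ⟨(integrable_comp_prodMk_iff hX hY hXY hpd hqd hXp hYq hF).2 hFint,
      condExp_comp_prodMk hX hY hXY hpd hqd hXp hYq hZd hpos hF hFint⟩
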